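/- Let $j\ge 1$ and $0\le\delta\le j/2$ be integers. Consider a discrete-time, work-conserving single-server queue with unit service rate. Jobs $1,2,\dots$ all have size $j$; job $1$ arrives at time $0$ in an empty system, and the inter-arrival times $Y_i$ (between the arrivals of jobs $i$ and $i+1$) are i.i.d. with $Y_i=j+1-\delta$ with probability $\tfrac12$ and $Y_i=j+1+\delta$ with probability $\tfrac12$. At the beginning of every time slot $t$ the server chooses, possibly preempting another job, which job in the system (including one that arrives at time $t$) is served for one unit during that slot. The sojourn time $W_i$ of job $i$ is its completion time minus its arrival time. Under FCFS (first come first serve) the server always serves the job in the system with the least arrival time. Under SPST (shortest predicted sojourn time) it serves, in every slot $t$, the job in the system with the shortest predicted sojourn time, i.e. the sojourn time that the job would have if it were chosen at time $t$ and run to completion without preemption (its time already spent in the system plus its remaining service requirement); ties are broken in favour of the job with the least arrival time. Let the reward of job $i$ be $e^{-\kappa W_i}$. If $\kappa\ge\ln 2$, then for each of $\pi=\mathrm{SPST}$ and $\pi=\mathrm{FCFS}$ the long-term average reward $$\bar r_\pi=\lim_{n\to\infty}\frac1n\sum_{i=1}^n e^{-\kappa W_i}$$ (with sojourn times under $\pi$)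 exists almost surely and is almost surely equal to a constant, and $$\bar r_{\mathrm{SPST}}\ \ge\ \bar r_{\mathrm{FCFS}} .$$ -/

import Mathlib

open MeasureTheory ProbabilityTheory Filter Topology
open scoped ENNReal

namespace Queue

/-- Arrival times: job `0` arrives at time `0`, and `Y i` is the time between the arrivals of the
jobs `i` and `i + 1`. -/
def arrival (Y : ℕ → ℕ) (i : ℕ) : ℕ := ∑ k ∈ Finset.range i, Y k

/-- Job `i` is in the system at the beginning of slot `t`, when the jobs have arrival times `a`
and remaining service requirements `r`: it has arrived (a job arriving at time `t` may be served
in slot `t`), and it is not yet completed. -/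
def InSystem (a : ℕ → ℕ) (t : ℕ) (r : ℕ → ℕ) (i : ℕ) : Prop := a i ≤ t ∧ 0 < r i

/-- A service discipline that, in every slot, serves a job of least index `π a t r i`; here `a` is
the sequence of arrival times, `t` the current slot, `r` the sequence of remaining service
requirements at the beginning of the slot, and `i` the job. -/
abbrev Discipline : Type := (ℕ → ℕ) → ℕ → (ℕ → ℕ) → ℕ → ℕ

/-- The sojourn time of job `i` if it is chosen by the server at time `t` and is run to completion
without preemption: it has spent `t - a i` in the system, and stays for `r i` further slots. -/
def predictedSojourn (a : ℕ → ℕ) (t : ℕ) (r : ℕ → ℕ) (i : ℕ) : ℕ := (t - a i) + r i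

/-- Shortest predicted sojourn time. -/
def SPST : Discipline := predictedSojourn

/-- First come first served. -/
def FCFS : Discipline := fun a _ _ i => a i

/-- Job `i` is the job in service in slot `t`: among the jobs in the system it minimises the
index of the discipline, and ties are broken in favour of the job that arrived first (jobs are
numbered in the order of their arrivals). -/
def InService (π : Discipline) (a : ℕ → ℕ) (t : ℕ) (r : ℕ → ℕ) (i : ℕ) : Prop :=
  InSystem a t r i ∧
    ∀ k, InSystem a t r k → π a t r i < π a t r k ∨ (π a t r i = π a t r k ∧ i ≤ k)

open Classical in
/-- Remaining service requirement of each job at the beginning of slot `t`, when the jobs have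
arrival times `a` and sizes `S`: the job in service receives one unit of service per slot. -/
noncomputable def remaining (π : Discipline) (a S : ℕ → ℕ) : ℕ → ℕ → ℕ
  | 0 => S
  | t + 1 => fun i =>
      if InService π a t (remaining π a S t) i then remaining π a S t i - 1
      else remaining π a S t i

/-- Sojourn time of job `i`: its completion time minus its arrival time, and `⊤` if it is never
completed. -/
noncomputable def sojourn (π : Discipline) (a S : ℕ → ℕ) (i : ℕ) : ℕ∞ :=
  ⨅ (t : ℕ) (_ : remaining π a S t i = 0), ((t - a i : ℕ) : ℕ∞)

open Classical in
/-- The reward `exp (-κ W)` of a job with sojourn time `W` (it is `0` for a job that is never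
completed). -/
noncomputable def reward (κ : ℝ) (W : ℕ∞) : ℝ :=
  if W = ⊤ then 0 else Real.exp (-κ * (W.toNat : ℝ))

/-- Average reward of the first `n` jobs, for interarrival times `Y` and jobs of equal size `j`. -/
noncomputable def averageReward (π : Discipline) (κ : ℝ) (j : ℕ) (Y : ℕ → ℕ) (n : ℕ) : ℝ :=
  (1 / (n : ℝ)) *
    ∑ i ∈ Finset.range n, reward κ (sojourn π (arrival Y) (fun _ => j) i)

/-- `r` is the long-term average reward under the discipline `π`: almost surely, the average
reward of the first `n` jobs tends to `r` as `n → ∞`. -/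
def IsLongTermAverageReward {Ω : Type*} [MeasurableSpace Ω] (μ : Measure Ω)
    (π : Discipline) (κ : ℝ) (j : ℕ) (Y : ℕ → Ω → ℕ) (r : ℝ) : Prop :=
  ∀ᵐ ω ∂μ, Tendsto (averageReward π κ j (fun i => Y i ω)) atTop (𝓝 r)

end Queue

namespace Queue

/-! Existence of the averages. Both disciplines rank jobs by age and remaining work only, so the
queue restarts afresh at each job that finds it empty. The work per gap exceeds the capacity by `j -
Y`, of mean `-1`; by a Chernoff bound a long stretch of jobs contains no such restart only with
geometrically small probability (`ArrivalLaw.exists_measure_busy_le`). Hence the reward of a job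
agrees, up to geometrically small probability, with a function of the gaps shortly before it, and
also with a function of the gaps up to shortly after it. So covariances of rewards decay
geometrically, expected rewards form a Cauchy sequence, and a second-moment strong law
(`ae_tendsto_average_of_covariance_le`) gives almost sure convergence to the limit of the
expectations.

Comparison. It remains to compare limits of expected rewards. If `δ ≤ 1`, every gap is at least `j`,
and under SPST every job attains the minimal sojourn time `j`. Let `δ ≥ 2`, `A = exp (-κ j)` and `B
= exp (-κ (j + δ - 1))`. Under FCFS a job preceded by a short gap stays at least `j + δ - 1`, so the
limit is at most `(A + B) / 2`. Under SPST a job is served at once, with sojourn time `j`, unless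
its predecessor was served at once and the gap between them is short; the probability `p` of this
solves `p = 1 - p / 2` in the limit, so `p = 2 / 3`. A job not served at once but followed by a long
gap stays at most `j + δ - 1`. The limit is thus at least `2 A / 3 + B / 6`, and this exceeds `(A +
B) / 2` exactly when `B ≤ A / 2`, which follows from `κ ≥ log 2` and `δ - 1 ≥ 1`. -/

/-- The inter-arrival times seen from job `s` on. -/
def shift (s : ℕ) (y : ℕ → ℕ) : ℕ → ℕ := fun k => y (s + k)

/-- Unfinished work found by job `b` on arrival, for jobs of size `j`. -/
def workload (j : ℕ) (y : ℕ → ℕ) : ℕ → ℕ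
  | 0 => 0
  | b + 1 => workload j y b + j - y b

/-- The order in which a discipline ranks the jobs in the system depends only on the ages and
the remaining service requirements of the jobs. -/
def AgeBased (π : Discipline) : Prop :=
  ∀ ⦃a t r i k a' t' r' i' k'⦄, a i ≤ t → a k ≤ t → a' i' ≤ t' → a' k' ≤ t' →
    t - a i = t' - a' i' → t - a k = t' - a' k' → r i = r' i' → r k = r' k' →
    (π a t r i < π a t r k ↔ π a' t' r' i' < π a' t' r' k')

lemma ageBased_SPST : AgeBased SPST := by
  intro a t r i k a' t' r' i' k' _ _ _ _ h1 h2 h3 h4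
  simp only [SPST, predictedSojourn, h1, h2, h3, h4]

lemma ageBased_FCFS : AgeBased FCFS := by
  intro a t r i k a' t' r' i' k' _ _ _ _ _ _ _ _
  simp only [FCFS]
  omega

lemma AgeBased.eq_iff {π : Discipline} (hπ : AgeBased π) {a t r i k a' t' r' i' k'}
    (h1 : a i ≤ t) (h2 : a k ≤ t) (h3 : a' i' ≤ t') (h4 : a' k' ≤ t')
    (h5 : t - a i = t' - a' i') (h6 : t - a k = t' - a' k') (h7 : r i = r' i')
    (h8 : r k = r' k') :
    (π a t r i = π a t r k ↔ π a' t' r' i' = π a' t' r' k') := by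
  have := hπ h1 h2 h3 h4 h5 h6 h7 h8
  have := hπ h2 h1 h4 h3 h6 h5 h8 h7
  omega

lemma arrival_succ (y : ℕ → ℕ) (i : ℕ) : arrival y (i + 1) = arrival y i + y i :=
  Finset.sum_range_succ _ _

lemma arrival_add (y : ℕ → ℕ) (s i : ℕ) :
    arrival y (s + i) = arrival y s + arrival (shift s y) i :=
  Finset.sum_range_add _ _ _

lemma arrival_strictMono {y : ℕ → ℕ} (hy : ∀ k, 0 < y k) : StrictMono (arrival y) :=
  strictMono_nat_of_lt_succ fun i => by rw [arrival_succ]; have := hy i; omega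

lemma arrival_congr {y y' : ℕ → ℕ} {b : ℕ} (h : ∀ k < b, y k = y' k) {i : ℕ} (hi : i ≤ b) :
    arrival y i = arrival y' i :=
  Finset.sum_congr rfl fun k hk => h k (lt_of_lt_of_le (Finset.mem_range.1 hk) hi)

/-! ### Dynamics of a single slot -/

section Service

variable {π : Discipline} {a S r : ℕ → ℕ} {t i k : ℕ}

lemma InService.unique (hi : InService π a t r i) (hk : InService π a t r k) : i = k := by
  have h1 := hi.2 k hk.1
  have h2 := hk.2 i hi.1
  omega

lemma exists_inService (ha : StrictMono a) (hk : InSystem a t r k) :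
    ∃ i, InService π a t r i := by
  classical
  have hfin : {i | InSystem a t r i}.Finite :=
    (Set.finite_Iic t).subset fun i hi => (ha.id_le i).trans hi.1
  obtain ⟨i, hi, hmin⟩ := hfin.toFinset.exists_min_image
    -- The lexicographic order on (index, job number) encodes the tie-breaking rule.
    (fun i => toLex (π a t r i, i)) ⟨k, by simpa using hk⟩
  refine ⟨i, by simpa using hi, fun k hk => ?_⟩
  have := hmin k (by simpa using hk)
  rwa [Prod.Lex.toLex_le_toLex] at this

lemma remaining_succ_of_inService (h : InService π a t (remaining π a S t) i) :
    remaining π a S (t + 1) i = remaining π a S t i - 1 := by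
  simp [remaining, h]

lemma remaining_succ_of_not_inService (h : ¬ InService π a t (remaining π a S t) i) :
    remaining π a S (t + 1) i = remaining π a S t i := by
  simp [remaining, h]

lemma remaining_succ_le : remaining π a S (t + 1) i ≤ remaining π a S t i := by
  by_cases h : InService π a t (remaining π a S t) i
  · rw [remaining_succ_of_inService h]; omega
  · rw [remaining_succ_of_not_inService h]

lemma remaining_le_succ : remaining π a S t i ≤ remaining π a S (t + 1) i + 1 := by
  by_cases h : InService π a t (remaining π a S t) i
  · rw [remaining_succ_of_inService h]; omega
  · rw [remaining_succ_of_not_inService h]; omega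

lemma remaining_antitone (π : Discipline) (a S : ℕ → ℕ) (i : ℕ) :
    Antitone fun t => remaining π a S t i :=
  antitone_nat_of_succ_le fun _ => remaining_succ_le

lemma remaining_of_le_arrival (h : t ≤ a i) : remaining π a S t i = S i := by
  induction t with
  | zero => rfl
  | succ t ih =>
    rw [remaining_succ_of_not_inService, ih (by omega)]
    intro hs
    have := hs.1.1
    omega

lemma sojourn_le (h : remaining π a S t i = 0) : sojourn π a S i ≤ ((t - a i : ℕ) : ℕ∞) :=
  iInf₂_le t h

end Service

/-- A discipline based on ages makes the same choice in two systems that hold the same jobs, up to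
a relabelling by a translation. -/
lemma AgeBased.inService_iff {π : Discipline} (hπ : AgeBased π) {a t r a' t' r'} {s : ℕ}
    (hold : ∀ k < s, ¬ InSystem a t r k)
    (hsys : ∀ i, InSystem a t r (s + i) ↔ InSystem a' t' r' i)
    (hage : ∀ i, InSystem a' t' r' i → t - a (s + i) = t' - a' i ∧ r (s + i) = r' i) (i : ℕ) :
    InService π a t r (s + i) ↔ InService π a' t' r' i := by
  have key : ∀ k, InSystem a' t' r' i → InSystem a' t' r' k →
      ((π a t r (s + i) < π a t r (s + k) ∨
        (π a t r (s + i) = π a t r (s + k) ∧ s + i ≤ s + k)) ↔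
      (π a' t' r' i < π a' t' r' k ∨ (π a' t' r' i = π a' t' r' k ∧ i ≤ k))) := by
    intro k hi hk
    rw [hπ ((hsys i).2 hi).1 ((hsys k).2 hk).1 hi.1 hk.1 (hage i hi).1 (hage k hk).1
      (hage i hi).2 (hage k hk).2, hπ.eq_iff ((hsys i).2 hi).1 ((hsys k).2 hk).1 hi.1 hk.1
      (hage i hi).1 (hage k hk).1 (hage i hi).2 (hage k hk).2, add_le_add_iff_left]
  constructor
  · rintro ⟨h1, h2⟩
    have h1' := (hsys i).1 h1
    exact ⟨h1', fun k hk => (key k h1' hk).1 (h2 _ ((hsys k).2 hk))⟩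
  · rintro ⟨h1, h2⟩
    refine ⟨(hsys i).2 h1, fun k hk => ?_⟩
    have hsk : s ≤ k := by
      by_contra hlt
      exact hold k (by omega) hk
    obtain ⟨m, rfl⟩ := Nat.exists_eq_add_of_le hsk
    have hm := (hsys m).1 hk
    exact (key m h1 hm).2 (h2 m hm)

/-! ### Work conservation and regeneration at jobs that find the system empty -/

section Regeneration

variable {π : Discipline} {j : ℕ} {y y' : ℕ → ℕ}

/-- Total remaining work of the jobs that arrive before job `b`. -/
lemma sum_remaining_succ (hy : ∀ k, 0 < y k) {b t : ℕ} (h1 : arrival y b ≤ t)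
    (h2 : t < arrival y (b + 1)) :
    ∑ i ∈ Finset.range (b + 1), remaining π (arrival y) (fun _ => j) (t + 1) i =
      ∑ i ∈ Finset.range (b + 1), remaining π (arrival y) (fun _ => j) t i - 1 := by
  have ha := arrival_strictMono hy
  set R := remaining π (arrival y) (fun _ => j) with hR
  have harr : ∀ i, arrival y i ≤ t ↔ i < b + 1 := fun i =>
    ⟨fun h => ha.lt_iff_lt.1 (h.trans_lt h2), fun h =>
      (ha.monotone (Nat.lt_succ_iff.1 h)).trans h1⟩
  by_cases hs : ∃ i, InService π (arrival y) t (R t) i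
  · obtain ⟨i, hi⟩ := hs
    have hib : i ∈ Finset.range (b + 1) := Finset.mem_range.2 ((harr i).1 hi.1.1)
    have hpos : 0 < R t i := hi.1.2
    rw [← Finset.add_sum_erase _ _ hib, ← Finset.add_sum_erase _ _ hib]
    have h3 : R (t + 1) i = R t i - 1 := remaining_succ_of_inService hi
    have h4 : ∑ k ∈ (Finset.range (b + 1)).erase i, R (t + 1) k =
        ∑ k ∈ (Finset.range (b + 1)).erase i, R t k := by
      refine Finset.sum_congr rfl fun k hk => remaining_succ_of_not_inService fun hk' => ?_
      exact (Finset.mem_erase.1 hk).1 (hk'.unique hi)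
    omega
  · have h0 : ∀ i ∈ Finset.range (b + 1), R t i = 0 := by
      intro i hi
      by_contra hne
      exact hs (exists_inService ha
        ⟨(harr i).2 (Finset.mem_range.1 hi), Nat.pos_of_ne_zero hne⟩)
    have h0' : ∀ i ∈ Finset.range (b + 1), R (t + 1) i = 0 := fun i hi =>
      Nat.eq_zero_of_le_zero ((h0 i hi) ▸ remaining_succ_le)
    rw [Finset.sum_eq_zero h0, Finset.sum_eq_zero h0', Nat.zero_sub]

/-- Every discipline is work conserving. -/
lemma sum_remaining_eq_workload (hy : ∀ k, 0 < y k) (b : ℕ) :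
    ∑ i ∈ Finset.range b, remaining π (arrival y) (fun _ => j) (arrival y b) i =
      workload j y b := by
  induction b with
  | zero => simp [workload]
  | succ b ih =>
    have key : ∀ s ≤ y b,
        ∑ i ∈ Finset.range (b + 1),
          remaining π (arrival y) (fun _ => j) (arrival y b + s) i = workload j y b + j - s := by
      intro s hs
      induction s with
      | zero =>
        rw [Finset.sum_range_succ, add_zero, ih, remaining_of_le_arrival le_rfl, Nat.sub_zero]
      | succ s ihs =>
        rw [← add_assoc, sum_remaining_succ hy (by omega) (by rw [arrival_succ]; omega),
          ihs (by omega)]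
        omega
    rw [arrival_succ, key _ le_rfl, workload]

lemma remaining_eq_zero_of_workload (hy : ∀ k, 0 < y k) {b : ℕ} (hb : workload j y b = 0)
    {i : ℕ} (hi : i < b) {t : ℕ} (ht : arrival y b ≤ t) :
    remaining π (arrival y) (fun _ => j) t i = 0 := by
  rw [← sum_remaining_eq_workload (π := π) hy, Finset.sum_eq_zero_iff] at hb
  exact Nat.eq_zero_of_le_zero
    ((remaining_antitone π _ _ i ht).trans (hb i (Finset.mem_range.2 hi)).le)

/-- When job `s` arrives all earlier jobs are complete, so from then on the service choices agree
slot by slot with those in the system that starts with job `s`. -/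
lemma remaining_shift (hπ : AgeBased π) (hy : ∀ k, 0 < y k) {s : ℕ}
    (hs : workload j y s = 0) (t i : ℕ) :
    remaining π (arrival y) (fun _ => j) (arrival y s + t) (s + i) =
      remaining π (arrival (shift s y)) (fun _ => j) t i := by
  induction t generalizing i with
  | zero =>
    rw [remaining_of_le_arrival]
    · rfl
    · exact (arrival_strictMono hy).monotone (by omega)
  | succ t ih =>
    have hiff := hπ.inService_iff (a := arrival y) (t := arrival y s + t)
      (r := remaining π (arrival y) (fun _ => j) (arrival y s + t)) (a' := arrival (shift s y))
      (t' := t) (r' := remaining π (arrival (shift s y)) (fun _ => j) t) (s := s)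
      (fun k hk h => h.2.ne' (remaining_eq_zero_of_workload hy hs hk (by omega)))
      (fun i => by unfold InSystem; rw [ih, arrival_add]; omega)
      (fun i hi => ⟨by rw [arrival_add]; omega, ih i⟩) i
    by_cases h : InService π (arrival (shift s y)) t
        (remaining π (arrival (shift s y)) (fun _ => j) t) i
    · rw [← add_assoc, remaining_succ_of_inService h, remaining_succ_of_inService (hiff.2 h), ih]
    · rw [← add_assoc, remaining_succ_of_not_inService h,
        remaining_succ_of_not_inService (mt hiff.1 h), ih]

/-- From a job that finds the system empty on, the system starts afresh. -/
lemma sojourn_shift (hπ : AgeBased π) (hj : 0 < j) (hy : ∀ k, 0 < y k) {s : ℕ}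
    (hs : workload j y s = 0) (i : ℕ) :
    sojourn π (arrival y) (fun _ => j) (s + i) =
      sojourn π (arrival (shift s y)) (fun _ => j) i := by
  apply le_antisymm
  · refine le_iInf₂ fun t ht => ?_
    refine (sojourn_le ((remaining_shift hπ hy hs t i).trans ht)).trans ?_
    rw [arrival_add]
    exact_mod_cast (by omega)
  · refine le_iInf₂ fun t ht => ?_
    -- Before its arrival the job still has its full size `j > 0`, so it cannot have been completed.
    have hst : arrival y s ≤ t := by
      by_contra hlt
      rw [remaining_of_le_arrival] at ht
      · omega
      · rw [arrival_add]; omega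
    obtain ⟨u, rfl⟩ := Nat.exists_eq_add_of_le hst
    refine (sojourn_le ((remaining_shift hπ hy hs u i).symm.trans ht)).trans ?_
    rw [arrival_add]
    exact_mod_cast (by omega)

/-- Causality: before job `b` arrives, the server has seen only the gaps that the two sequences
share. -/
lemma remaining_congr (hπ : AgeBased π) (hy : ∀ k, 0 < y k) (hy' : ∀ k, 0 < y' k) {b : ℕ}
    (h : ∀ k < b, y k = y' k) {t : ℕ} (ht : t ≤ arrival y b) :
    remaining π (arrival y) (fun _ => j) t = remaining π (arrival y') (fun _ => j) t := by
  induction t with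
  | zero => rfl
  | succ t ih =>
    have ha := arrival_strictMono hy
    have ha' := arrival_strictMono hy'
    have hb := arrival_congr h le_rfl
    have ih := ih (by omega)
    have harr : ∀ i, arrival y i ≤ t ∨ arrival y' i ≤ t → arrival y i = arrival y' i := by
      intro i hi
      apply arrival_congr h
      rcases hi with hi | hi
      · exact (ha.lt_iff_lt.1 (by omega : arrival y i < arrival y b)).le
      · exact (ha'.lt_iff_lt.1 (by omega : arrival y' i < arrival y' b)).le
    funext i
    have hiff := hπ.inService_iff (a := arrival y) (t := t)
      (r := remaining π (arrival y) (fun _ => j) t) (a' := arrival y')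
      (t' := t) (r' := remaining π (arrival y') (fun _ => j) t) (s := 0)
      (fun k hk => absurd hk (by omega))
      (fun i => by
        unfold InSystem
        rw [ih, zero_add]
        have := harr i
        constructor <;> rintro ⟨h1, h2⟩ <;> refine ⟨?_, h2⟩ <;> omega)
      (fun i hi => ⟨by rw [zero_add, harr i (Or.inr hi.1)], by rw [ih, zero_add]⟩) i
    rw [zero_add] at hiff
    by_cases h : InService π (arrival y') t (remaining π (arrival y') (fun _ => j) t) i
    · rw [remaining_succ_of_inService h, remaining_succ_of_inService (hiff.2 h), ih]
    · rw [remaining_succ_of_not_inService h, remaining_succ_of_not_inService (mt hiff.1 h), ih]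

lemma workload_congr {b : ℕ} (h : ∀ k < b, y k = y' k) {c : ℕ} (hc : c ≤ b) :
    workload j y c = workload j y' c := by
  induction c with
  | zero => rfl
  | succ c ih => rw [workload, workload, ih (by omega), h c (by omega)]

lemma sojourn_le_of_agree (hπ : AgeBased π) (hy : ∀ k, 0 < y k) (hy' : ∀ k, 0 < y' k) {b : ℕ}
    (h : ∀ k < b, y k = y' k) (hb : workload j y b = 0) {i : ℕ} (hi : i < b) :
    sojourn π (arrival y) (fun _ => j) i ≤ sojourn π (arrival y') (fun _ => j) i := by
  refine le_iInf₂ fun t ht => ?_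
  rw [← arrival_congr h hi.le]
  rcases le_total t (arrival y b) with htb | htb
  · rw [← remaining_congr hπ hy hy' h htb] at ht
    exact sojourn_le ht
  -- By work conservation job `i` is complete under `y` when job `b` arrives, hence no later than at
  -- `t`.
  · refine (sojourn_le (remaining_eq_zero_of_workload hy hb hi le_rfl)).trans ?_
    exact_mod_cast (by omega)

/-- The sojourn times of the jobs before a job that finds the system empty do not depend on
the later arrivals. -/
lemma sojourn_congr (hπ : AgeBased π) (hy : ∀ k, 0 < y k) (hy' : ∀ k, 0 < y' k) {b : ℕ}
    (h : ∀ k < b, y k = y' k) (hb : workload j y b = 0) {i : ℕ} (hi : i < b) :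
    sojourn π (arrival y) (fun _ => j) i = sojourn π (arrival y') (fun _ => j) i :=
  le_antisymm (sojourn_le_of_agree hπ hy hy' h hb hi)
    (sojourn_le_of_agree hπ hy' hy (fun k hk => (h k hk).symm)
      ((workload_congr h le_rfl).symm.trans hb) hi)

/-- Starting empty at job `p` can only reduce the work; so a job that finds the original system
empty also finds the restarted one empty. -/
lemma workload_shift_le (p c : ℕ) : workload j (shift p y) c ≤ workload j y (p + c) := by
  induction c with
  | zero => simp [workload]
  | succ c ih =>
    rw [← add_assoc, workload, workload, shift]
    omega

/-- Take `s` to be the last job up to `e` that finds the system empty: from there on the subtraction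
in the workload recursion is never truncated. -/
lemma exists_workload_eq_sum (j : ℕ) (y : ℕ → ℕ) (e : ℕ) :
    ∃ s ≤ e, workload j y s = 0 ∧
      (workload j y e : ℤ) = ∑ k ∈ Finset.Ico s e, ((j : ℤ) - y k) := by
  induction e with
  | zero => exact ⟨0, le_rfl, rfl, by simp [workload]⟩
  | succ e ih =>
    obtain ⟨s, hs, h0, hsum⟩ := ih
    rcases Nat.eq_zero_or_pos (workload j y (e + 1)) with h | h
    · exact ⟨e + 1, le_rfl, h, by simp [h]⟩
    · refine ⟨s, by omega, h0, ?_⟩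
      rw [Finset.sum_Ico_succ_top hs, ← hsum]
      rw [workload] at h ⊢
      omega

/-- If no job in `[p, e]` finds the system empty, then the work that arrives from some job before
`p` on exceeds the capacity. -/
lemma exists_sum_pos_of_workload_pos {p e : ℕ} (hpe : p ≤ e)
    (h : ∀ c, p ≤ c → c ≤ e → workload j y c ≠ 0) :
    ∃ s < p, 0 < ∑ k ∈ Finset.Ico s e, ((j : ℤ) - y k) := by
  obtain ⟨s, hs, h0, hsum⟩ := exists_workload_eq_sum j y e
  have hsp : s < p := by
    by_contra hlt
    exact h s (by omega) hs h0
  refine ⟨s, hsp, hsum ▸ ?_⟩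
  have := h e hpe le_rfl
  omega

end Regeneration

end Queue

namespace Queue

/-! ### Sojourn bounds valid for every discipline -/

section Bounds

variable {π : Discipline} {a S : ℕ → ℕ} {i k t : ℕ}

/-- The predicted sojourn time of a job never decreases. -/
lemma age_add_remaining_mono {t' : ℕ} (hat : a k ≤ t) (h : t ≤ t') :
    t - a k + remaining π a S t k ≤ t' - a k + remaining π a S t' k := by
  induction t', h using Nat.le_induction with
  | base => exact le_rfl
  | succ u hu ih =>
    have := remaining_le_succ (π := π) (a := a) (S := S) (t := u) (i := k)
    omega

lemma size_le_age_add_remaining (hat : a k ≤ t) : S k ≤ t - a k + remaining π a S t k := by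
  have := age_add_remaining_mono (π := π) (S := S) (le_refl (a k)) hat
  rw [remaining_of_le_arrival le_rfl] at this
  omega

lemma le_sojourn {w : ℕ} (h : ∀ t, remaining π a S t i = 0 → w ≤ t - a i) :
    (w : ℕ∞) ≤ sojourn π a S i :=
  le_iInf₂ fun t ht => by exact_mod_cast h t ht

lemma size_le_sojourn : (S i : ℕ∞) ≤ sojourn π a S i := by
  refine le_sojourn fun t ht => ?_
  rcases le_total t (a i) with h | h
  · rw [remaining_of_le_arrival h] at ht
    omega
  · have := size_le_age_add_remaining (π := π) (S := S) h
    omega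

end Bounds

/-! ### Delay after a short gap under FCFS -/

section FCFS

variable {a S : ℕ → ℕ}

lemma remaining_FCFS_succ_of_pos (ha : StrictMono a) (i : ℕ) {t : ℕ}
    (h : 0 < remaining FCFS a S t i) : remaining FCFS a S t (i + 1) = S (i + 1) := by
  induction t with
  | zero => rfl
  | succ t ih =>
    have hpos : 0 < remaining FCFS a S t i := h.trans_le remaining_succ_le
    rw [remaining_succ_of_not_inService, ih hpos]
    intro hs
    have hlt := ha (Nat.lt_add_one i)
    have h1 := hs.1.1
    have := hs.2 i ⟨by omega, hpos⟩
    simp only [FCFS] at this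
    omega

/-- The server removes at most one unit per slot from the joint work of two consecutive jobs. -/
lemma two_jobs_le_age_add_remaining {π : Discipline} (ha : StrictMono a) {i t : ℕ}
    (hat : a i ≤ t) :
    S i + S (i + 1) ≤ t - a i + (remaining π a S t i + remaining π a S t (i + 1)) := by
  induction t, hat using Nat.le_induction with
  | base =>
    rw [remaining_of_le_arrival le_rfl, remaining_of_le_arrival (ha (Nat.lt_add_one i)).le]
    omega
  | succ t ht ih =>
    have h1 := remaining_le_succ (π := π) (a := a) (S := S) (t := t) (i := i)
    have h2 := remaining_le_succ (π := π) (a := a) (S := S) (t := t) (i := i + 1)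
    by_cases h : InService π a t (remaining π a S t) i
    · have : ¬ InService π a t (remaining π a S t) (i + 1) := fun h' => by
        have := h.unique h'
        omega
      rw [remaining_succ_of_not_inService this]
      omega
    · rw [remaining_succ_of_not_inService h]
      omega

/-- Job `i + 1` leaves only after job `i`, so at least `2 * j` slots after the arrival of job `i`;
subtracting the gap `j + 1 - δ` leaves `j + δ - 1`. -/
lemma le_sojourn_FCFS {j δ : ℕ} {y : ℕ → ℕ} (hj : 0 < j) (hδ : 2 * δ ≤ j) (hδ2 : 2 ≤ δ) (hy : ∀ k, 0 < y k)
    {i : ℕ} (hi : y i = j + 1 - δ) :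
    ((j + (δ - 1) : ℕ) : ℕ∞) ≤ sojourn FCFS (arrival y) (fun _ => j) (i + 1) := by
  have ha := arrival_strictMono hy
  refine le_sojourn fun t ht => ?_
  have hat : arrival y (i + 1) < t := by
    by_contra hlt
    rw [remaining_of_le_arrival (by omega)] at ht
    omega
  have h0 : remaining FCFS (arrival y) (fun _ => j) t i = 0 := by
    by_contra hne
    have := remaining_FCFS_succ_of_pos ha i (Nat.pos_of_ne_zero hne)
    omega
  rw [arrival_succ] at hat ⊢
  have := two_jobs_le_age_add_remaining (π := FCFS) (S := fun _ => j) ha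
    (show arrival y i ≤ t by omega)
  rw [h0, ht] at this
  omega

end FCFS

/-! ### Jobs served without interruption under SPST -/

section SPST

variable {a : ℕ → ℕ} {j i : ℕ}

lemma SPST_apply (a : ℕ → ℕ) (t : ℕ) (r : ℕ → ℕ) (k : ℕ) : SPST a t r k = t - a k + r k := rfl

/-- All jobs in the system when job `i` arrives have already been waiting. -/
def Fresh (a : ℕ → ℕ) (j i : ℕ) : Prop :=
  ∀ k < i, remaining SPST a (fun _ => j) (a i) k = 0 ∨
    j < a i - a k + remaining SPST a (fun _ => j) (a i) k

lemma Fresh.lt_of_pos (ha : StrictMono a) (h : Fresh a j i) {k t : ℕ} (hk : k < i)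
    (ht : a i ≤ t) (hpos : 0 < remaining SPST a (fun _ => j) t k) :
    j < t - a k + remaining SPST a (fun _ => j) t k := by
  have h1 := remaining_antitone SPST a (fun _ => j) k ht
  have h2 := age_add_remaining_mono (π := SPST) (S := fun _ => j) (ha hk).le ht
  have h3 := h k hk
  simp only at h1
  omega

/-- While job `i` is served its predicted sojourn time stays equal to `j`. Older unfinished jobs
have more than `j`, and later arrivals at least `j`, losing ties. -/
lemma Fresh.inService (ha : StrictMono a) (h : Fresh a j i) {s : ℕ} (hs : s < j)
    (hr : remaining SPST a (fun _ => j) (a i + s) i = j - s) :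
    InService SPST a (a i + s) (remaining SPST a (fun _ => j) (a i + s)) i := by
  refine ⟨⟨by omega, by omega⟩, fun k hk => ?_⟩
  simp only [SPST_apply, hr]
  rcases lt_or_ge k i with hki | hki
  · have := h.lt_of_pos ha hki (by omega) hk.2
    omega
  · have := size_le_age_add_remaining (π := SPST) (S := fun _ => j) hk.1
    omega

lemma Fresh.remaining_eq (ha : StrictMono a) (h : Fresh a j i) {s : ℕ} (hs : s ≤ j) :
    remaining SPST a (fun _ => j) (a i + s) i = j - s := by
  induction s with
  | zero => exact remaining_of_le_arrival le_rfl
  | succ s ih =>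
    have hr := ih (by omega)
    rw [← add_assoc, remaining_succ_of_inService (h.inService ha (by omega) hr), hr]
    omega

lemma Fresh.remaining_eq_of_ne (ha : StrictMono a) (h : Fresh a j i) {k : ℕ} (hk : k ≠ i) {s : ℕ}
    (hs : s ≤ j) :
    remaining SPST a (fun _ => j) (a i + s) k = remaining SPST a (fun _ => j) (a i) k := by
  induction s with
  | zero => rfl
  | succ s ih =>
    rw [← add_assoc, remaining_succ_of_not_inService, ih (by omega)]
    intro hs'
    exact hk (hs'.unique (h.inService ha (by omega) (h.remaining_eq ha (by omega))))

lemma Fresh.sojourn_le (ha : StrictMono a) (h : Fresh a j i) :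
    sojourn SPST a (fun _ => j) i ≤ j := by
  refine (Queue.sojourn_le ((h.remaining_eq ha le_rfl).trans (Nat.sub_self j))).trans ?_
  exact_mod_cast (by omega)

lemma Fresh.zero_of_le (ha : StrictMono a) (h : Fresh a j i) {t : ℕ} (ht : a i + j ≤ t) :
    remaining SPST a (fun _ => j) t i = 0 := by
  have h1 := h.remaining_eq ha le_rfl
  have h2 := remaining_antitone SPST a (fun _ => j) i ht
  simp only at h2
  omega

lemma Fresh.succ (ha : StrictMono a) (h : Fresh a j i) (hi : a i + j ≤ a (i + 1)) :
    Fresh a j (i + 1) := by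
  intro k hk
  rcases Nat.lt_succ_iff_lt_or_eq.1 hk with hk | rfl
  · exact (Nat.eq_zero_or_pos _).imp_right (h.lt_of_pos ha hk (ha (Nat.lt_add_one i)).le)
  · exact Or.inl (h.zero_of_le ha hi)

lemma Fresh.next_untouched (ha : StrictMono a) (h : Fresh a j i) :
    remaining SPST a (fun _ => j) (a i + j) (i + 1) = j := by
  rw [h.remaining_eq_of_ne ha (by omega) le_rfl,
    remaining_of_le_arrival (ha (Nat.lt_add_one i)).le]

/-- Job `i + 1` arrives strictly before job `i` finishes and is untouched until then, so its
predicted sojourn time already exceeds `j`. -/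
lemma Fresh.add_two (ha : StrictMono a) (h : Fresh a j i) (hi : a (i + 1) < a i + j)
    (hi' : a i + j ≤ a (i + 2)) : Fresh a j (i + 2) := by
  intro k hk
  rcases Nat.lt_succ_iff_lt_or_eq.1 hk with hk | rfl
  · rcases Nat.lt_succ_iff_lt_or_eq.1 hk with hk | rfl
    · exact (Nat.eq_zero_or_pos _).imp_right
        (h.lt_of_pos ha hk (ha (show i < i + 2 by omega)).le)
    · exact Or.inl (h.zero_of_le ha hi')
  · right
    have h1 := age_add_remaining_mono (π := SPST) (S := fun _ => j) hi.le hi'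
    rw [h.next_untouched ha] at h1
    omega

/-- When job `i` is done, older jobs have been idle for `j` slots and have predicted sojourn time
above `2 * j`. That of job `i + 1` is less than `2 * j` and stays constant during its service, so it
is served next, and no new job arrives before it ends. -/
lemma Fresh.next_remaining_eq (ha : StrictMono a) (h : Fresh a j i)
    (hi : a (i + 1) ≤ a i + j) (hi' : a i + 2 * j ≤ a (i + 2)) {s : ℕ} (hs : s ≤ j) :
    remaining SPST a (fun _ => j) (a i + j + s) (i + 1) = j - s := by
  induction s with
  | zero => exact h.next_untouched ha
  | succ s ih =>
    have hr := ih (by omega)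
    rw [← add_assoc, remaining_succ_of_inService, hr]
    · omega
    refine ⟨⟨by omega, by omega⟩, fun k hk => ?_⟩
    simp only [SPST_apply, hr]
    have hk1 : a k ≤ a i + j + s := hk.1
    have hk2 : k < i + 2 := ha.lt_iff_lt.1 (show a k < a (i + 2) by omega)
    have hii := ha (Nat.lt_add_one i)
    rcases Nat.lt_succ_iff_lt_or_eq.1 hk2 with hk2 | rfl
    · left
      rcases Nat.lt_succ_iff_lt_or_eq.1 hk2 with hki | rfl
      · have h1 := age_add_remaining_mono (π := SPST) (a := a) (S := fun _ => j) (k := k)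
          (t := a i + j) (t' := a i + j + s) (by have := ha hki; omega) (by omega)
        have h2 := remaining_antitone SPST a (fun _ => j) k
          (show a i ≤ a i + j + s by omega)
        have h3 := h.lt_of_pos ha hki le_rfl (lt_of_lt_of_le hk.2 h2)
        rw [h.remaining_eq_of_ne ha hki.ne le_rfl] at h1
        have := ha hki
        omega
      · exact absurd hk.2 (by rw [h.zero_of_le ha (by omega)]; omega)
    · right
      omega

lemma Fresh.next_sojourn_le (ha : StrictMono a) (h : Fresh a j i)
    (hi : a (i + 1) ≤ a i + j) (hi' : a i + 2 * j ≤ a (i + 2)) :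
    sojourn SPST a (fun _ => j) (i + 1) ≤ ((a i + 2 * j - a (i + 1) : ℕ) : ℕ∞) := by
  refine (Queue.sojourn_le ((h.next_remaining_eq ha hi hi' le_rfl).trans (Nat.sub_self j))).trans ?_
  exact_mod_cast (by omega)

/-- Under SPST, job `i` is served without interruption as soon as it arrives: this is the case
unless the previous job is served in this way and is still in service when job `i` arrives. -/
def ServedAtOnce (j δ : ℕ) (y : ℕ → ℕ) : ℕ → Prop
  | 0 => True
  | i + 1 => ¬ (ServedAtOnce j δ y i ∧ y i = j + 1 - δ)

variable {δ : ℕ} {y : ℕ → ℕ}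

/-- Either the previous job was served at once and a long gap let it finish, or it was made to wait
by the job before it. In the latter case two gaps last at least `2 * (j + 1 - δ) ≥ j`, enough for
that earlier job to finish, while the waiting job has become less urgent than a new one. -/
lemma ServedAtOnce.fresh (hδ : 2 * δ ≤ j) (hδ2 : 2 ≤ δ)
    (hy : ∀ k, y k = j + 1 - δ ∨ y k = j + 1 + δ) (i : ℕ) :
    ServedAtOnce j δ y i → Fresh (arrival y) j i := by
  have ha : StrictMono (arrival y) :=
    arrival_strictMono fun k => by have := hy k; omega
  induction i using Nat.strong_induction_on with
  | _ i ih =>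
    intro hs
    match i, ih, hs with
    | 0, _, _ => exact fun k hk => absurd hk (Nat.not_lt_zero k)
    | i + 1, ih, hs =>
      by_cases hi : ServedAtOnce j δ y i
      · refine (ih i (by omega) hi).succ ha ?_
        have h1 : y i ≠ j + 1 - δ := fun h => hs ⟨hi, h⟩
        have := hy i
        rw [arrival_succ]
        omega
      · match i, ih, hi with
        | 0, _, hi => exact absurd trivial hi
        | i + 1, ih, hi =>
          obtain ⟨h1, h2⟩ := not_not.1 hi
          refine (ih i (by omega) h1).add_two ha ?_ ?_
          · rw [arrival_succ]; omega
          · have := hy (i + 1)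
            rw [arrival_succ, arrival_succ]
            omega

lemma ServedAtOnce.sojourn_le (hδ : 2 * δ ≤ j) (hδ2 : 2 ≤ δ)
    (hy : ∀ k, y k = j + 1 - δ ∨ y k = j + 1 + δ) {i : ℕ} (hi : ServedAtOnce j δ y i) :
    sojourn SPST (arrival y) (fun _ => j) i ≤ j :=
  (hi.fresh hδ hδ2 hy).sojourn_le (arrival_strictMono fun k => by have := hy k; omega)

/-- The job waits `δ - 1` slots for its predecessor. The two gaps around it add up to `2 * j + 2`,
so it then finishes before the next arrival. -/
lemma sojourn_le_of_not_servedAtOnce (hδ : 2 * δ ≤ j) (hδ2 : 2 ≤ δ)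
    (hy : ∀ k, y k = j + 1 - δ ∨ y k = j + 1 + δ) {i : ℕ} (hi : ¬ ServedAtOnce j δ y i)
    (hyi : y i = j + 1 + δ) :
    sojourn SPST (arrival y) (fun _ => j) i ≤ ((j + (δ - 1) : ℕ) : ℕ∞) := by
  match i, hi, hyi with
  | 0, hi, _ => exact absurd trivial hi
  | i + 1, hi, hyi =>
    obtain ⟨h1, h2⟩ := not_not.1 hi
    have e1 := arrival_succ y i
    have e2 : arrival y (i + 2) = arrival y (i + 1) + y (i + 1) := arrival_succ y (i + 1)
    refine ((h1.fresh hδ hδ2 hy).next_sojourn_le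
      (arrival_strictMono fun k => by have := hy k; omega) (by omega) (by omega)).trans ?_
    exact_mod_cast (by omega)

lemma sojourn_SPST_le_of_size_le (hj : 0 < j) (hy : ∀ k, j ≤ y k) (i : ℕ) :
    sojourn SPST (arrival y) (fun _ => j) i ≤ j := by
  have ha : StrictMono (arrival y) := arrival_strictMono fun k => hj.trans_le (hy k)
  refine Fresh.sojourn_le ha ?_
  induction i with
  | zero => exact fun k hk => absurd hk (Nat.not_lt_zero k)
  | succ i ih => exact ih.succ ha (by rw [arrival_succ]; have := hy i; omega)

end SPST

end Queue

/-! ### A strong law under summable covariance decay -/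

section CovarianceDecay

variable {Ω : Type*} [MeasurableSpace Ω] {μ : Measure Ω}

lemma sum_comp_le_tsum {ι : Type*} {γ : ℕ → ℝ} (hγ : Summable γ) (h0 : ∀ n, 0 ≤ γ n)
    (s : Finset ι) {e : ι → ℕ} (he : Set.InjOn e s) : ∑ k ∈ s, γ (e k) ≤ ∑' n, γ n := by
  classical
  rw [← Finset.sum_image (g := e) (f := γ) he]
  exact hγ.sum_le_tsum _ fun n _ => h0 n

/-- The sum of the squares has finite expectation, so it is almost surely finite and its terms tend
to zero. -/
lemma ae_tendsto_zero_of_summable_integral_sq {Z : ℕ → Ω → ℝ} (hm : ∀ n, MemLp (Z n) 2 μ)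
    {u : ℕ → ℝ} (hu : Summable u) (h : ∀ n, ∫ ω, Z n ω ^ 2 ∂μ ≤ u n) :
    ∀ᵐ ω ∂μ, Tendsto (fun n => Z n ω) atTop (𝓝 0) := by
  have hu0 : ∀ n, 0 ≤ u n := fun n => (integral_nonneg fun ω => sq_nonneg _).trans (h n)
  have hlint : ∀ n, ∫⁻ ω, ENNReal.ofReal (Z n ω ^ 2) ∂μ ≤ ENNReal.ofReal (u n) := fun n => by
    rw [← ofReal_integral_eq_lintegral_ofReal (hm n).integrable_sq
      (ae_of_all _ fun ω => sq_nonneg _)]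
    exact ENNReal.ofReal_le_ofReal (h n)
  have hmeas : ∀ n, AEMeasurable (fun ω => ENNReal.ofReal (Z n ω ^ 2)) μ := fun n =>
    ((hm n).aestronglyMeasurable.aemeasurable.pow_const 2).ennreal_ofReal
  have hfin : ∫⁻ ω, ∑' n, ENNReal.ofReal (Z n ω ^ 2) ∂μ ≠ ⊤ := by
    rw [lintegral_tsum hmeas]
    exact ne_top_of_le_ne_top hu.tsum_ofReal_ne_top (ENNReal.tsum_le_tsum hlint)
  filter_upwards [ae_lt_top' (AEMeasurable.tsum hmeas) hfin] with ω hω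
  have h1 := (ENNReal.tendsto_toReal ENNReal.zero_ne_top).comp
    (ENNReal.tendsto_atTop_zero_of_tsum_ne_top hω.ne)
  have h2 : Tendsto (fun n => Z n ω ^ 2) atTop (𝓝 0) := by
    refine h1.congr fun n => ?_
    simp [ENNReal.toReal_ofReal (sq_nonneg (Z n ω))]
  have h3 := h2.sqrt
  simp only [Real.sqrt_sq_eq_abs, Real.sqrt_zero] at h3
  exact (tendsto_zero_iff_abs_tendsto_zero _).2 h3

variable [IsProbabilityMeasure μ]

lemma integrable_of_mem_Icc {f : Ω → ℝ} (hm : Measurable f) (h : ∀ ω, f ω ∈ Set.Icc (0 : ℝ) 1) :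
    Integrable f μ :=
  Integrable.of_bound hm.aestronglyMeasurable 1 (ae_of_all _ fun ω => by
    rw [Real.norm_eq_abs, abs_of_nonneg (h ω).1]; exact (h ω).2)

lemma memLp_two_of_mem_Icc {f : Ω → ℝ} (hm : Measurable f)
    (h : ∀ ω, f ω ∈ Set.Icc (0 : ℝ) 1) : MemLp f 2 μ :=
  MemLp.of_bound hm.aestronglyMeasurable 1 (ae_of_all _ fun ω => by
    rw [Real.norm_eq_abs, abs_of_nonneg (h ω).1]; exact (h ω).2)

/-- The variance of a sum grows at most linearly if the covariances decay summably. -/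
lemma variance_sum_le {f : ℕ → Ω → ℝ} (hm : ∀ i, MemLp (f i) 2 μ) {γ : ℕ → ℝ}
    (hγ : Summable γ) (h0 : ∀ n, 0 ≤ γ n)
    (hcov : ∀ i k, i ≤ k → |cov[f i, f k; μ]| ≤ γ (k - i)) (n : ℕ) :
    Var[∑ i ∈ Finset.range n, f i; μ] ≤ n * (2 * ∑' m, γ m) := by
  rw [variance_sum' fun i _ => hm i]
  calc ∑ i ∈ Finset.range n, ∑ k ∈ Finset.range n, cov[f i, f k; μ]
      ≤ ∑ i ∈ Finset.range n, 2 * ∑' m, γ m := ?_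
    _ = n * (2 * ∑' m, γ m) := by simp
  refine Finset.sum_le_sum fun i _ => ?_
  rw [← Finset.sum_filter_add_sum_filter_not (Finset.range n) (fun k => k ≤ i), two_mul]
  refine add_le_add ?_ ?_
  · refine le_trans (Finset.sum_le_sum fun k hk => ?_)
      (sum_comp_le_tsum hγ h0 ((Finset.range n).filter (fun k => k ≤ i)) (e := fun k => i - k) ?_)
    · rw [covariance_comm]
      exact (le_abs_self _).trans (hcov k i (Finset.mem_filter.1 hk).2)
    · intro k hk l hl hkl
      have h1 := (Finset.mem_filter.1 hk).2
      have h2 := (Finset.mem_filter.1 hl).2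
      simp only at hkl
      omega
  · refine le_trans (Finset.sum_le_sum fun k hk => ?_)
      (sum_comp_le_tsum hγ h0 ((Finset.range n).filter (fun k => ¬ k ≤ i))
        (e := fun k => k - i) ?_)
    · exact (le_abs_self _).trans (hcov i k (by have := (Finset.mem_filter.1 hk).2; omega))
    · intro k hk l hl hkl
      have h1 := (Finset.mem_filter.1 hk).2
      have h2 := (Finset.mem_filter.1 hl).2
      simp only at hkl
      omega

/-- Strong law of large numbers for bounded variables with summably decaying covariances. -/
lemma ae_tendsto_average_of_covariance_le {f : ℕ → Ω → ℝ} (hm : ∀ i, Measurable (f i))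
    (hf : ∀ i ω, f i ω ∈ Set.Icc (0 : ℝ) 1) {γ : ℕ → ℝ} (hγ : Summable γ) (h0 : ∀ n, 0 ≤ γ n)
    (hcov : ∀ i k, i ≤ k → |cov[f i, f k; μ]| ≤ γ (k - i)) {l : ℝ}
    (hl : Tendsto (fun i => ∫ ω, f i ω ∂μ) atTop (𝓝 l)) :
    ∀ᵐ ω ∂μ, Tendsto (fun n : ℕ => (1 / (n : ℝ)) * ∑ i ∈ Finset.range n, f i ω) atTop (𝓝 l) := by
  have hL : ∀ i, MemLp (f i) 2 μ := fun i => memLp_two_of_mem_Icc (hm i) (hf i)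
  -- Along the squares the variance of the average is `O(1 / (n + 1) ^ 2)`, which is summable. As
  -- the partial sums are monotone and `c (n + 1) / c n` tends to `1`, convergence along this
  -- subsequence suffices.
  set c : ℕ → ℕ := fun n => (n + 1) ^ 2 with hc
  have hcpos : ∀ n, (0 : ℝ) < c n := fun n => by simp only [hc]; positivity
  have hctop : Tendsto c atTop atTop :=
    tendsto_atTop_mono (fun n => by simp only [hc, id]; nlinarith) tendsto_id
  set E : ℕ → ℝ := fun n => ∑ i ∈ Finset.range n, ∫ ω, f i ω ∂μ with hE
  have hZ := ae_tendsto_zero_of_summable_integral_sq (μ := μ)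
    (Z := fun n ω => ((c n : ℝ))⁻¹ * ((∑ i ∈ Finset.range (c n), f i) ω - E (c n)))
    (u := fun n => (2 * ∑' m, γ m) * (1 / ((n + 1 : ℕ) : ℝ) ^ 2))
    (fun n => by
      have h1 : MemLp (∑ i ∈ Finset.range (c n), f i) 2 μ := memLp_finsetSum' _ fun i _ => hL i
      exact (h1.sub (memLp_const (E (c n)))).const_mul _)
    (((summable_nat_add_iff 1).2 (Real.summable_one_div_nat_pow.2 one_lt_two)).mul_left _)
    (fun n => by
      have h1 : MemLp (∑ i ∈ Finset.range (c n), f i) 2 μ := memLp_finsetSum' _ fun i _ => hL i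
      have h2 : E (c n) = ∫ ω, (∑ i ∈ Finset.range (c n), f i) ω ∂μ := by
        simp only [Finset.sum_apply]
        rw [integral_finsetSum _ fun i _ => integrable_of_mem_Icc (hm i) (hf i)]
      simp only [mul_pow]
      rw [integral_const_mul, h2, ← variance_eq_integral h1.aestronglyMeasurable.aemeasurable]
      have h3 := variance_sum_le hL hγ h0 hcov (c n)
      calc ((c n : ℝ)⁻¹) ^ 2 * Var[∑ i ∈ Finset.range (c n), f i; μ]
          ≤ ((c n : ℝ)⁻¹) ^ 2 * (c n * (2 * ∑' m, γ m)) := by gcongr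
        _ = (2 * ∑' m, γ m) * (1 / ((n + 1 : ℕ) : ℝ) ^ 2) := by
          have := (hcpos n).ne'
          field_simp
          simp only [hc]
          push_cast
          ring)
  filter_upwards [hZ] with ω hω
  have hmono : Monotone fun n => ∑ i ∈ Finset.range n, f i ω :=
    monotone_nat_of_le_succ fun n => by
      rw [Finset.sum_range_succ]
      exact le_add_of_nonneg_right (hf n ω).1
  have hsub : Tendsto (fun n => (∑ i ∈ Finset.range (c n), f i ω) / (c n : ℝ)) atTop (𝓝 l) := by
    have h1 := hω.add (hl.cesaro.comp hctop)
    rw [zero_add] at h1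
    refine h1.congr fun n => ?_
    simp only [Function.comp, hE, Finset.sum_apply]
    ring
  refine (tendsto_div_of_monotone_of_exists_subseq_tendsto_div _ l hmono fun a ha =>
    ⟨c, ?_, hctop, hsub⟩).congr fun n => by ring
  have ha' : 0 < a - 1 := by linarith
  -- `(n + 2) ^ 2 ≤ a * (n + 1) ^ 2` holds as soon as `(a - 1) * n ≥ 3`.
  filter_upwards [eventually_ge_atTop ⌈3 / (a - 1)⌉₊] with n hn
  have h1 : 3 / (a - 1) ≤ n := (Nat.le_ceil _).trans (by exact_mod_cast hn)
  rw [div_le_iff₀ ha'] at h1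
  simp only [hc]
  push_cast
  have hn0 : (0 : ℝ) ≤ n := Nat.cast_nonneg n
  nlinarith

lemma abs_integral_sub_le {f f' : Ω → ℝ} (hm : Measurable f)
    (hf : ∀ ω, f ω ∈ Set.Icc (0 : ℝ) 1) (hm' : Measurable f')
    (hf' : ∀ ω, f' ω ∈ Set.Icc (0 : ℝ) 1) :
    ∫ ω, |f ω - f' ω| ∂μ ≤ μ.real {ω | f ω ≠ f' ω} := by
  have hset : MeasurableSet {ω | f ω ≠ f' ω} := (measurableSet_eq_fun hm hm').compl
  rw [← integral_indicator_one hset]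
  refine integral_mono ?_ ((integrable_const (1 : ℝ)).indicator hset) fun ω => ?_
  · exact ((integrable_of_mem_Icc hm hf).sub (integrable_of_mem_Icc hm' hf')).abs
  · by_cases h : f ω = f' ω
    · simp [h]
    · rw [Set.indicator_of_mem (by exact h), Pi.one_apply, abs_le]
      have := hf ω
      have := hf' ω
      simp only [Set.mem_Icc] at *
      constructor <;> linarith

lemma abs_integral_sub_integral_le {f f' : Ω → ℝ} (hm : Measurable f)
    (hf : ∀ ω, f ω ∈ Set.Icc (0 : ℝ) 1) (hm' : Measurable f')
    (hf' : ∀ ω, f' ω ∈ Set.Icc (0 : ℝ) 1) :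
    |∫ ω, f ω ∂μ - ∫ ω, f' ω ∂μ| ≤ μ.real {ω | f ω ≠ f' ω} := by
  rw [← integral_sub (integrable_of_mem_Icc hm hf) (integrable_of_mem_Icc hm' hf')]
  exact abs_integral_le_integral_abs.trans (abs_integral_sub_le hm hf hm' hf')

/-- Variables that agree with independent variables with high probability have a small
covariance. -/
lemma abs_covariance_le {f f' g g' : Ω → ℝ} (hfm : Measurable f)
    (hf : ∀ ω, f ω ∈ Set.Icc (0 : ℝ) 1) (hfm' : Measurable f')
    (hf' : ∀ ω, f' ω ∈ Set.Icc (0 : ℝ) 1) (hgm : Measurable g)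
    (hg : ∀ ω, g ω ∈ Set.Icc (0 : ℝ) 1) (hgm' : Measurable g')
    (hg' : ∀ ω, g' ω ∈ Set.Icc (0 : ℝ) 1) (hind : IndepFun f' g' μ) :
    |cov[f, g; μ]| ≤ 2 * (μ.real {ω | f ω ≠ f' ω} + μ.real {ω | g ω ≠ g' ω}) := by
  have hf1 := abs_integral_sub_le (μ := μ) hfm hf hfm' hf'
  have hg1 := abs_integral_sub_le (μ := μ) hgm hg hgm' hg'
  have hf2 := abs_integral_sub_integral_le (μ := μ) hfm hf hfm' hf'
  have hg2 := abs_integral_sub_integral_le (μ := μ) hgm hg hgm' hg'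
  have hIf := integrable_of_mem_Icc (μ := μ) hfm hf
  have hIf' := integrable_of_mem_Icc (μ := μ) hfm' hf'
  have hIg := integrable_of_mem_Icc (μ := μ) hgm hg
  have hIg' := integrable_of_mem_Icc (μ := μ) hgm' hg'
  have hmul : ∀ {u v : Ω → ℝ}, (∀ ω, u ω ∈ Set.Icc (0 : ℝ) 1) →
      (∀ ω, v ω ∈ Set.Icc (0 : ℝ) 1) → ∀ ω, u ω * v ω ∈ Set.Icc (0 : ℝ) 1 := fun hu hv ω =>
    ⟨mul_nonneg (hu ω).1 (hv ω).1, mul_le_one₀ (hu ω).2 (hv ω).1 (hv ω).2⟩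
  have hIfg := integrable_of_mem_Icc (μ := μ) (hfm.mul hgm) (hmul hf hg)
  have hIfg' := integrable_of_mem_Icc (μ := μ) (hfm'.mul hgm') (hmul hf' hg')
  have h3 : |∫ ω, (f * g) ω ∂μ - ∫ ω, (f' * g') ω ∂μ| ≤
      μ.real {ω | f ω ≠ f' ω} + μ.real {ω | g ω ≠ g' ω} := by
    rw [← integral_sub hIfg hIfg']
    refine abs_integral_le_integral_abs.trans (le_trans ?_ (add_le_add hf1 hg1))
    have hIff : Integrable (fun ω => |f ω - f' ω|) μ := (hIf.sub hIf').abs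
    have hIgg : Integrable (fun ω => |g ω - g' ω|) μ := (hIg.sub hIg').abs
    rw [← integral_add hIff hIgg]
    refine integral_mono (hIfg.sub hIfg').abs (hIff.add hIgg) fun ω => ?_
    simp only [Pi.mul_apply]
    have e : f ω * g ω - f' ω * g' ω = (f ω - f' ω) * g ω + f' ω * (g ω - g' ω) := by ring
    rw [e]
    refine (abs_add_le _ _).trans (add_le_add ?_ ?_)
    · rw [abs_mul, abs_of_nonneg (hg ω).1]
      exact mul_le_of_le_one_right (abs_nonneg _) (hg ω).2
    · rw [abs_mul, abs_of_nonneg (hf' ω).1]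
      exact mul_le_of_le_one_left (abs_nonneg _) (hf' ω).2
  have h4 : ∫ ω, (f' * g') ω ∂μ = (∫ ω, f' ω ∂μ) * ∫ ω, g' ω ∂μ :=
    hind.integral_mul_eq_mul_integral hfm'.aestronglyMeasurable hgm'.aestronglyMeasurable
  have hbd : ∀ {u : Ω → ℝ}, Measurable u → (∀ ω, u ω ∈ Set.Icc (0 : ℝ) 1) →
      0 ≤ ∫ ω, u ω ∂μ ∧ ∫ ω, u ω ∂μ ≤ 1 := fun hum hu =>
    ⟨integral_nonneg fun ω => (hu ω).1, by
      simpa using integral_mono (integrable_of_mem_Icc (μ := μ) hum hu) (integrable_const 1)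
        fun ω => (hu ω).2⟩
  rw [covariance_eq_sub (memLp_two_of_mem_Icc hfm hf) (memLp_two_of_mem_Icc hgm hg)]
  have h5 : |(∫ ω, f ω ∂μ) * (∫ ω, g ω ∂μ) - (∫ ω, f' ω ∂μ) * ∫ ω, g' ω ∂μ| ≤
      μ.real {ω | f ω ≠ f' ω} + μ.real {ω | g ω ≠ g' ω} := by
    have e : (∫ ω, f ω ∂μ) * (∫ ω, g ω ∂μ) - (∫ ω, f' ω ∂μ) * ∫ ω, g' ω ∂μ =
      (∫ ω, f ω ∂μ - ∫ ω, f' ω ∂μ) * (∫ ω, g ω ∂μ) +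
        (∫ ω, f' ω ∂μ) * (∫ ω, g ω ∂μ - ∫ ω, g' ω ∂μ) := by ring
    rw [e]
    refine (abs_add_le _ _).trans (add_le_add ?_ ?_)
    · rw [abs_mul, abs_of_nonneg (hbd hgm hg).1]
      exact (mul_le_of_le_one_right (abs_nonneg _) (hbd hgm hg).2).trans hf2
    · rw [abs_mul, abs_of_nonneg (hbd hfm' hf').1]
      exact (mul_le_of_le_one_left (abs_nonneg _) (hbd hfm' hf').2).trans hg2
  rw [h4] at h3
  rw [abs_le] at *
  constructor <;> linarith [h3.1, h3.2, h5.1, h5.2]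

end CovarianceDecay

namespace Queue

/-- Reward of job `i`, for jobs of equal size `j` and inter-arrival times `y`. -/
noncomputable def jobReward (π : Discipline) (κ : ℝ) (j : ℕ) (y : ℕ → ℕ) (i : ℕ) : ℝ :=
  reward κ (sojourn π (arrival y) (fun _ => j) i)

/-! ### Monotonicity of the reward in the sojourn time -/

section Reward

variable {κ : ℝ} {W : ℕ∞}

lemma reward_mem_Icc (hκ : 0 ≤ κ) (W : ℕ∞) : reward κ W ∈ Set.Icc (0 : ℝ) 1 := by
  unfold reward
  split_ifs
  · simp
  · refine ⟨(Real.exp_pos _).le, Real.exp_le_one_iff.2 ?_⟩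
    have := mul_nonneg hκ (Nat.cast_nonneg (α := ℝ) W.toNat)
    linarith

lemma reward_le_of_le (hκ : 0 ≤ κ) {w : ℕ} (h : (w : ℕ∞) ≤ W) :
    reward κ W ≤ Real.exp (-κ * w) := by
  unfold reward
  split_ifs with hW
  · exact (Real.exp_pos _).le
  · obtain ⟨n, rfl⟩ := ENat.ne_top_iff_exists.1 hW
    have hn : (w : ℝ) ≤ n := by exact_mod_cast h
    rw [ENat.toNat_natCast]
    exact Real.exp_le_exp.2 (by nlinarith)

lemma le_reward_of_le (hκ : 0 ≤ κ) {w : ℕ} (h : W ≤ (w : ℕ∞)) :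
    Real.exp (-κ * w) ≤ reward κ W := by
  have hW : W ≠ ⊤ := ne_top_of_le_ne_top (ENat.natCast_ne_top w) h
  unfold reward
  rw [if_neg hW]
  obtain ⟨n, rfl⟩ := ENat.ne_top_iff_exists.1 hW
  have hn : (n : ℝ) ≤ w := by exact_mod_cast h
  rw [ENat.toNat_natCast]
  exact Real.exp_le_exp.2 (by nlinarith)

end Reward

/-! ### Measurability of rewards in the inter-arrival times -/

section Measurability

/-- The index of a discipline depends measurably on the arrival times and on the remaining service
requirements. -/
def MeasurableDiscipline (π : Discipline) : Prop :=
  ∀ t i, Measurable fun p : (ℕ → ℕ) × (ℕ → ℕ) => π p.1 t p.2 i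

lemma measurableDiscipline_FCFS : MeasurableDiscipline FCFS := fun t i => by
  unfold FCFS
  fun_prop

lemma measurableDiscipline_SPST : MeasurableDiscipline SPST := fun t i => by
  unfold SPST predictedSojourn
  exact (measurable_const.sub ((measurable_pi_apply i).comp measurable_fst)).add
    ((measurable_pi_apply i).comp measurable_snd)

lemma measurable_arrival (i : ℕ) : Measurable fun y => arrival y i :=
  Finset.measurable_fun_sum _ fun k _ => measurable_pi_apply k

lemma measurableSet_inSystem {r : (ℕ → ℕ) → ℕ → ℕ} (hr : ∀ k, Measurable fun y => r y k)
    (t k : ℕ) : MeasurableSet {y | InSystem (arrival y) t (r y) k} :=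
  (measurableSet_le (measurable_arrival k) measurable_const).inter
    (measurableSet_lt measurable_const (hr k))

variable {π : Discipline}

lemma measurableSet_inService (hπ : MeasurableDiscipline π) {r : (ℕ → ℕ) → ℕ → ℕ}
    (hr : ∀ k, Measurable fun y => r y k) (t i : ℕ) :
    MeasurableSet {y | InService π (arrival y) t (r y) i} := by
  have hidx : ∀ k, Measurable fun y => π (arrival y) t (r y) k := fun k =>
    (hπ t k).comp ((measurable_pi_lambda _ measurable_arrival).prodMk (measurable_pi_lambda _ hr))
  have : {y | InService π (arrival y) t (r y) i} =
      {y | InSystem (arrival y) t (r y) i} ∩ ⋂ k, ({y | InSystem (arrival y) t (r y) k}ᶜ ∪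
        ({y | π (arrival y) t (r y) i < π (arrival y) t (r y) k} ∪
          ({y | π (arrival y) t (r y) i = π (arrival y) t (r y) k} ∩ {_y | i ≤ k}))) := by
    ext y
    simp only [InService, Set.mem_ofPred_eq, Set.mem_inter_iff, Set.mem_iInter, Set.mem_union,
      Set.mem_compl_iff, imp_iff_not_or]
  rw [this]
  exact (measurableSet_inSystem hr t i).inter (MeasurableSet.iInter fun k =>
    (measurableSet_inSystem hr t k).compl.union ((measurableSet_lt (hidx i) (hidx k)).union
      ((measurableSet_eq_fun (hidx i) (hidx k)).inter (MeasurableSet.const _))))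

lemma measurable_remaining (hπ : MeasurableDiscipline π) (S : ℕ → ℕ) (t i : ℕ) :
    Measurable fun y => remaining π (arrival y) S t i := by
  induction t generalizing i with
  | zero => exact measurable_const
  | succ t ih =>
    simp only [remaining]
    exact Measurable.ite (measurableSet_inService hπ ih t i) ((ih i).sub measurable_const) (ih i)

lemma measurable_sojourn (hπ : MeasurableDiscipline π) (S : ℕ → ℕ) (i : ℕ) :
    Measurable fun y => sojourn π (arrival y) S i := by
  classical
  have : BorelSpace ℕ∞ := ⟨borel_eq_top_of_countable.symm⟩
  unfold sojourn
  refine Measurable.iInf fun t => ?_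
  have : (fun y => ⨅ _ : remaining π (arrival y) S t i = 0, ((t - arrival y i : ℕ) : ℕ∞)) =
      fun y => if remaining π (arrival y) S t i = 0 then ((t - arrival y i : ℕ) : ℕ∞) else ⊤ := by
    funext y
    split_ifs with h <;> simp [h]
  rw [this]
  refine Measurable.ite (measurableSet_eq_fun (measurable_remaining hπ S t i) measurable_const)
    ?_ measurable_const
  exact (Measurable.of_discrete (f := fun n : ℕ => (n : ℕ∞))).comp
    (measurable_const.sub (measurable_arrival i))

lemma measurable_jobReward (hπ : MeasurableDiscipline π) (κ : ℝ) (j i : ℕ) :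
    Measurable fun y => jobReward π κ j y i :=
  (Measurable.of_discrete (f := reward κ)).comp (measurable_sojourn hπ _ i)

end Measurability

/-- The inter-arrival times `y` up to job `b`, followed by constant ones. -/
def truncate (c b : ℕ) (y : ℕ → ℕ) : ℕ → ℕ := fun k => if k < b then y k else c

lemma measurable_shift (s : ℕ) : Measurable (shift s) :=
  measurable_pi_lambda _ fun k => measurable_pi_apply (s + k)

lemma measurable_truncate (c b : ℕ) : Measurable (truncate c b) :=
  measurable_pi_lambda _ fun k => by
    unfold truncate
    split_ifs
    · exact measurable_pi_apply k
    · exact measurable_const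

lemma truncate_of_lt {c b k : ℕ} (hk : k < b) (y : ℕ → ℕ) : truncate c b y k = y k := if_pos hk

lemma truncate_pos {c b : ℕ} {y : ℕ → ℕ} (hc : 0 < c) (hy : ∀ k, 0 < y k) (k : ℕ) :
    0 < truncate c b y k := by
  unfold truncate
  split_ifs
  exacts [hy k, hc]

/-! ### Localising the reward: forgetting the past or the future -/

section Coupling

variable {π : Discipline} {j : ℕ} {y : ℕ → ℕ}

/-- If some job in `[p, p + m]` finds the system empty, the original system and the one restarted at
`p` both regenerate there and give job `p + m` the same sojourn time. -/
lemma exists_sum_pos_of_jobReward_shift_ne (hπ : AgeBased π) (hj : 0 < j) (hy : ∀ k, 0 < y k)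
    {κ : ℝ} {p m : ℕ} (h : jobReward π κ j y (p + m) ≠ jobReward π κ j (shift p y) m) :
    ∃ s < p, 0 < ∑ k ∈ Finset.Ico s (p + m), ((j : ℤ) - y k) := by
  refine exists_sum_pos_of_workload_pos (Nat.le_add_right p m) fun c hpc hcm h0 => h ?_
  obtain ⟨q, rfl⟩ := Nat.exists_eq_add_of_le hpc
  obtain ⟨n, rfl⟩ := Nat.exists_eq_add_of_le (show q ≤ m by omega)
  have h1 : workload j (shift p y) q = 0 :=
    Nat.eq_zero_of_le_zero ((workload_shift_le p q).trans h0.le)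
  have h2 : shift q (shift p y) = shift (p + q) y := funext fun k => by
    simp only [shift, add_assoc]
  unfold jobReward
  rw [← add_assoc, sojourn_shift hπ hj hy h0, sojourn_shift (y := shift p y) hπ hj (fun k => hy (p + k)) h1,
    h2]

lemma exists_sum_pos_of_jobReward_truncate_ne (hπ : AgeBased π) (hy : ∀ k, 0 < y k)
    {κ : ℝ} {c i b : ℕ} (hc : 0 < c) (hib : i < b)
    (h : jobReward π κ j y i ≠ jobReward π κ j (truncate c b y) i) :
    ∃ s < i + 1, 0 < ∑ k ∈ Finset.Ico s b, ((j : ℤ) - y k) := by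
  refine exists_sum_pos_of_workload_pos hib fun q hiq hqb h0 => h ?_
  unfold jobReward
  rw [sojourn_congr hπ hy (truncate_pos hc hy) (b := q) (fun k hk => ?_) h0 hiq]
  rw [truncate_of_lt (by omega)]

end Coupling

/-! ### Probability estimates for the arrival process -/

section Law

variable {Ω : Type*} [MeasurableSpace Ω] {μ : Measure Ω} {j δ : ℕ} {Y : ℕ → Ω → ℕ}

/-- The inter-arrival times are independent and equal `j + 1 - δ` or `j + 1 + δ` with probability
one half each. -/
structure ArrivalLaw (μ : Measure Ω) (j δ : ℕ) (Y : ℕ → Ω → ℕ) : Prop where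
  measurable : ∀ i, Measurable (Y i)
  indep : iIndepFun Y μ
  map_eq : ∀ i, μ.map (Y i) =
    (1 / 2 : ℝ≥0∞) • Measure.dirac (j + 1 - δ) + (1 / 2 : ℝ≥0∞) • Measure.dirac (j + 1 + δ)

namespace ArrivalLaw

lemma measurable_path (h : ArrivalLaw μ j δ Y) : Measurable fun ω k => Y k ω :=
  measurable_pi_lambda _ h.measurable

lemma ae_eq_or_eq (h : ArrivalLaw μ j δ Y) :
    ∀ᵐ ω ∂μ, ∀ k, Y k ω = j + 1 - δ ∨ Y k ω = j + 1 + δ := by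
  rw [ae_all_iff]
  intro k
  have h1 : ∀ᵐ n ∂(μ.map (Y k)), n = j + 1 - δ ∨ n = j + 1 + δ := by
    rw [h.map_eq, ae_add_measure_iff]
    constructor <;> refine Measure.ae_smul_measure ?_ _ <;> rw [ae_dirac_eq] <;> simp
  exact ae_of_ae_map (h.measurable k).aemeasurable h1

lemma integral_comp (h : ArrivalLaw μ j δ Y) (g : ℕ → ℝ) (i : ℕ) :
    ∫ ω, g (Y i ω) ∂μ = (g (j + 1 - δ) + g (j + 1 + δ)) / 2 := by
  have hg : StronglyMeasurable g := (Measurable.of_discrete).stronglyMeasurable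
  have hi : ∀ n : ℕ, Integrable g ((1 / 2 : ℝ≥0∞) • Measure.dirac n) := fun n =>
    (integrable_dirac (by simp)).smul_measure (by simp)
  rw [← integral_map (h.measurable i).aemeasurable hg.aestronglyMeasurable, h.map_eq,
    integral_add_measure (hi _) (hi _), integral_smul_measure, integral_smul_measure,
    integral_dirac, integral_dirac]
  simp
  ring

lemma indepFun_truncate_shift (h : ArrivalLaw μ j δ Y) (c b : ℕ) :
    IndepFun (fun ω => truncate c b fun k => Y k ω) (fun ω => shift b fun k => Y k ω) μ := by
  have h1 := indep_iSup_of_disjoint (m := fun k => MeasurableSpace.comap (Y k) inferInstance)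
    (fun k => (h.measurable k).comap_le) h.indep (S := Set.Iio b) (T := Set.Ici b)
    (Set.disjoint_left.2 fun k hk hk' => absurd (Set.mem_Iio.1 hk) (not_lt.2 hk'))
  refine indep_of_indep_of_le_left (indep_of_indep_of_le_right h1 ?_) ?_
  · rw [← measurable_iff_comap_le]
    refine @measurable_pi_lambda _ _ _ (_) _ _ fun k => ?_
    exact (comap_measurable (Y (b + k))).mono
      (le_iSup₂_of_le (b + k) (Nat.le_add_right b k) le_rfl) le_rfl
  · rw [← measurable_iff_comap_le]
    refine @measurable_pi_lambda _ _ _ (_) _ _ fun k => ?_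
    unfold truncate
    split_ifs with hk
    · exact (comap_measurable (Y k)).mono (le_iSup₂_of_le k hk le_rfl) le_rfl
    · exact measurable_const

/-- The transform is `exp (-θ) * cosh (θ δ) ≤ exp (-θ + θ² δ² / 2)`, and `θ = 1 / (δ² + 1)` makes `θ
δ² ≤ 1`, leaving decay `exp (-θ / 2)`, also for `δ = 0`. -/
lemma mgf_le (h : ArrivalLaw μ j δ Y) (hδ : 2 * δ ≤ j) (k : ℕ) :
    mgf (fun ω => (j : ℝ) - Y k ω) μ (1 / ((δ : ℝ) ^ 2 + 1)) ≤
      Real.exp (-(1 / ((δ : ℝ) ^ 2 + 1)) / 2) := by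
  set θ : ℝ := 1 / ((δ : ℝ) ^ 2 + 1) with hθ
  have hθ0 : 0 < θ := by positivity
  have hθδ : θ * ((δ : ℝ) ^ 2 + 1) = 1 := by rw [hθ]; field_simp
  unfold mgf
  rw [h.integral_comp (fun n => Real.exp (θ * ((j : ℝ) - n))) k]
  have e1 : θ * ((j : ℝ) - ((j + 1 - δ : ℕ) : ℝ)) = -θ + θ * δ := by
    rw [Nat.cast_sub (by omega)]; push_cast; ring
  have e2 : θ * ((j : ℝ) - ((j + 1 + δ : ℕ) : ℝ)) = -θ + -(θ * δ) := by push_cast; ring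
  simp only [e1, e2, Real.exp_add]
  rw [← mul_add, mul_div_assoc, ← Real.cosh_eq]
  calc Real.exp (-θ) * Real.cosh (θ * δ)
      ≤ Real.exp (-θ) * Real.exp ((θ * δ) ^ 2 / 2) := by
        gcongr
        exact Real.cosh_le_exp_half_sq _
    _ = Real.exp (-θ + (θ * δ) ^ 2 / 2) := (Real.exp_add _ _).symm
    _ ≤ Real.exp (-θ / 2) := Real.exp_le_exp.2 (by nlinarith)

variable [IsProbabilityMeasure μ]

lemma map_shift (h : ArrivalLaw μ j δ Y) (s : ℕ) :
    μ.map (fun ω => shift s fun k => Y k ω) = μ.map (fun ω k => Y k ω) := by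
  have h1 := (iIndepFun_iff_map_fun_eq_infinitePi_map h.measurable).1 h.indep
  have h2 := (iIndepFun_iff_map_fun_eq_infinitePi_map fun k => h.measurable (s + k)).1
    (h.indep.precomp (add_right_injective s))
  rw [h1]
  refine h2.trans ?_
  simp only [h.map_eq]

lemma integral_shift (h : ArrivalLaw μ j δ Y) {F : (ℕ → ℕ) → ℝ} (hF : Measurable F) (s : ℕ) :
    ∫ ω, F (shift s fun k => Y k ω) ∂μ = ∫ ω, F (fun k => Y k ω) ∂μ := by
  rw [← integral_map (φ := fun ω => shift s fun k => Y k ω)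
      ((measurable_shift s).comp h.measurable_path).aemeasurable
      hF.aestronglyMeasurable, h.map_shift,
    integral_map h.measurable_path.aemeasurable hF.aestronglyMeasurable]

/-- Chernoff bound for the work that arrives during a period to exceed the capacity. -/
lemma measure_sum_pos_le (h : ArrivalLaw μ j δ Y) (hδ : 2 * δ ≤ j) (s e : ℕ) :
    μ.real {ω | 0 < ∑ k ∈ Finset.Ico s e, ((j : ℤ) - Y k ω)} ≤
      Real.exp (-(1 / ((δ : ℝ) ^ 2 + 1)) / 2) ^ (e - s) := by
  set θ : ℝ := 1 / ((δ : ℝ) ^ 2 + 1) with hθ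
  have hθ0 : 0 < θ := by positivity
  set X : ℕ → Ω → ℝ := fun k ω => (j : ℝ) - Y k ω with hX
  have hXm : ∀ k, Measurable (X k) := fun k =>
    measurable_const.sub ((Measurable.of_discrete (f := fun n : ℕ => (n : ℝ))).comp
      (h.measurable k))
  have hXi : iIndepFun X μ := h.indep.comp (fun _ n => (j : ℝ) - n) fun _ => Measurable.of_discrete
  have hint : Integrable (fun ω => Real.exp (θ * (∑ k ∈ Finset.Ico s e, X k) ω)) μ := by
    refine Integrable.of_bound (C := Real.exp (θ * ∑ k ∈ Finset.Ico s e, (j : ℝ))) ?_ ?_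
    · simp only [Finset.sum_apply]
      exact ((Finset.measurable_fun_sum _ fun k _ => hXm k).const_mul θ).exp.aestronglyMeasurable
    · refine ae_of_all _ fun ω => ?_
      rw [Real.norm_eq_abs, Real.abs_exp, Finset.sum_apply]
      refine Real.exp_le_exp.2 (mul_le_mul_of_nonneg_left (Finset.sum_le_sum fun k _ => ?_) hθ0.le)
      simp only [hX]
      linarith [Nat.cast_nonneg (α := ℝ) (Y k ω)]
  have h1 := measure_ge_le_exp_mul_mgf (μ := μ) 0 hθ0.le hint
  rw [mul_zero, Real.exp_zero, one_mul, hXi.mgf_sum hXm] at h1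
  calc μ.real {ω | 0 < ∑ k ∈ Finset.Ico s e, ((j : ℤ) - Y k ω)}
      ≤ μ.real {ω | 0 ≤ (∑ k ∈ Finset.Ico s e, X k) ω} := by
        refine measureReal_mono fun ω hω => ?_
        have : (0 : ℝ) < ((∑ k ∈ Finset.Ico s e, ((j : ℤ) - Y k ω) : ℤ) : ℝ) := by
          exact_mod_cast hω
        push_cast at this
        simpa [hX] using this.le
    _ ≤ ∏ k ∈ Finset.Ico s e, mgf (X k) μ θ := h1
    _ ≤ ∏ _k ∈ Finset.Ico s e, Real.exp (-θ / 2) :=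
        Finset.prod_le_prod (fun k _ => mgf_nonneg) fun k _ => h.mgf_le hδ k
    _ = Real.exp (-θ / 2) ^ (e - s) := by simp

/-- There is little chance that the system does not empty during a long period. -/
lemma exists_measure_busy_le (h : ArrivalLaw μ j δ Y) (hδ : 2 * δ ≤ j) :
    ∃ K ρ : ℝ, 1 ≤ K ∧ 0 < ρ ∧ ρ < 1 ∧ ∀ p e : ℕ, p ≤ e →
      μ.real {ω | ∃ s < p, 0 < ∑ k ∈ Finset.Ico s e, ((j : ℤ) - Y k ω)} ≤ K * ρ ^ (e - p) := by
  set ρ : ℝ := Real.exp (-(1 / ((δ : ℝ) ^ 2 + 1)) / 2) with hρ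
  have hρ0 : 0 < ρ := Real.exp_pos _
  have hρ1 : ρ < 1 := Real.exp_lt_one_iff.2 (by
    have : (0 : ℝ) < 1 / ((δ : ℝ) ^ 2 + 1) := by positivity
    linarith)
  have hK : 1 ≤ (1 - ρ)⁻¹ := (one_le_inv₀ (by linarith)).2 (by linarith)
  refine ⟨(1 - ρ)⁻¹, ρ, hK, hρ0, hρ1, fun p e hpe => ?_⟩
  have hset : {ω | ∃ s < p, 0 < ∑ k ∈ Finset.Ico s e, ((j : ℤ) - Y k ω)} =
      ⋃ s ∈ Finset.range p, {ω | 0 < ∑ k ∈ Finset.Ico s e, ((j : ℤ) - Y k ω)} := by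
    ext ω
    simp
  rw [hset]
  calc μ.real (⋃ s ∈ Finset.range p, {ω | 0 < ∑ k ∈ Finset.Ico s e, ((j : ℤ) - Y k ω)})
      ≤ ∑ s ∈ Finset.range p, μ.real {ω | 0 < ∑ k ∈ Finset.Ico s e, ((j : ℤ) - Y k ω)} :=
        measureReal_biUnion_finset_le _ _
    -- Union bound over the starting point `s`; the factor `ρ ^ (p - s)` sums to at most `(1 -
    -- ρ)⁻¹`, uniformly in `p`.
    _ ≤ ∑ s ∈ Finset.range p, ρ ^ (e - p) * ρ ^ (p - s) := Finset.sum_le_sum fun s hs => by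
        have hs := Finset.mem_range.1 hs
        rw [← pow_add, show e - p + (p - s) = e - s by omega]
        exact h.measure_sum_pos_le hδ s e
    _ = ρ ^ (e - p) * ∑ s ∈ Finset.range p, ρ ^ (p - s) := (Finset.mul_sum _ _ _).symm
    _ ≤ ρ ^ (e - p) * (1 - ρ)⁻¹ := by
        gcongr
        rw [← tsum_geometric_of_lt_one hρ0.le hρ1]
        refine sum_comp_le_tsum (summable_geometric_of_lt_one hρ0.le hρ1)
          (fun n => by positivity) _ fun a ha b hb hab => ?_
        have := Finset.mem_range.1 ha
        have := Finset.mem_range.1 hb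
        omega
    _ = (1 - ρ)⁻¹ * ρ ^ (e - p) := mul_comm _ _

end ArrivalLaw

end Law

end Queue

namespace Queue

/-! ### Almost sure convergence of the average reward -/

section LongTermAverage

variable {Ω : Type*} [MeasurableSpace Ω] {μ : Measure Ω} [IsProbabilityMeasure μ]
  {j δ : ℕ} {Y : ℕ → Ω → ℕ} {π : Discipline} {κ : ℝ}

lemma measureReal_le_of_ae_imp {p q : Ω → Prop} (h : ∀ᵐ ω ∂μ, p ω → q ω) :
    μ.real {ω | p ω} ≤ μ.real {ω | q ω} :=
  ENNReal.toReal_mono (measure_ne_top μ _) (measure_mono_ae h)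

lemma summable_pow_half {ρ : ℝ} (h0 : 0 < ρ) (h1 : ρ < 1) :
    Summable fun n : ℕ => ρ ^ ((n - 1) / 2) := by
  set σ := √ρ with hσ
  have hσ0 : 0 < σ := Real.sqrt_pos.2 h0
  have hσ1 : σ < 1 := by
    rw [hσ, Real.sqrt_lt' one_pos]
    simpa using h1
  have hσ2 : ρ = σ ^ 2 := (Real.sq_sqrt h0.le).symm
  refine Summable.of_nonneg_of_le (fun n => by positivity) (fun n => ?_)
    ((summable_geometric_of_lt_one hσ0.le hσ1).mul_left (σ ^ 2)⁻¹)
  rw [inv_mul_eq_div, le_div_iff₀ (by positivity), hσ2, ← pow_mul, ← pow_add]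
  exact pow_le_pow_of_le_one hσ0.le hσ1.le (by omega)

namespace ArrivalLaw

omit [IsProbabilityMeasure μ] in
lemma ae_pos (h : ArrivalLaw μ j δ Y) (hδ : 2 * δ ≤ j) : ∀ᵐ ω ∂μ, ∀ k, 0 < Y k ω := by
  filter_upwards [h.ae_eq_or_eq] with ω hω k
  have := hω k
  omega

omit [IsProbabilityMeasure μ] in
lemma measurable_jobReward_path (h : ArrivalLaw μ j δ Y) (hπ : MeasurableDiscipline π) (i : ℕ) :
    Measurable fun ω => jobReward π κ j (fun k => Y k ω) i :=
  (measurable_jobReward hπ κ j i).comp h.measurable_path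

/-- The average reward converges almost surely to the limit of the expected rewards. -/
theorem exists_isLongTermAverageReward (h : ArrivalLaw μ j δ Y) (hj : 0 < j) (hδ : 2 * δ ≤ j)
    (hκ : 0 ≤ κ) (hπ : AgeBased π) (hπm : MeasurableDiscipline π) :
    ∃ r, IsLongTermAverageReward μ π κ j Y r ∧
      Tendsto (fun i => ∫ ω, jobReward π κ j (fun k => Y k ω) i ∂μ) atTop (𝓝 r) := by
  obtain ⟨K, ρ, hK, hρ0, hρ1, hbusy⟩ := h.exists_measure_busy_le hδ
  have hm := fun i => h.measurable_jobReward_path (κ := κ) hπm i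
  have hmem : ∀ y i, jobReward π κ j y i ∈ Set.Icc (0 : ℝ) 1 := fun y i => reward_mem_Icc hκ _
  have hms : ∀ p i, Measurable fun ω => jobReward π κ j (shift p fun k => Y k ω) i := fun p i =>
    (measurable_jobReward hπm κ j i).comp ((measurable_shift p).comp h.measurable_path)
  have hmt : ∀ b i, Measurable fun ω => jobReward π κ j (truncate 1 b fun k => Y k ω) i :=
    fun b i => (measurable_jobReward hπm κ j i).comp
      ((measurable_truncate 1 b).comp h.measurable_path)
  have hpast : ∀ p m, μ.real {ω | jobReward π κ j (fun k => Y k ω) (p + m) ≠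
      jobReward π κ j (shift p fun k => Y k ω) m} ≤ K * ρ ^ m := fun p m => by
    refine (measureReal_le_of_ae_imp ?_).trans
      ((hbusy p (p + m) (Nat.le_add_right p m)).trans_eq (by rw [Nat.add_sub_cancel_left]))
    filter_upwards [h.ae_pos hδ] with ω hω hne
    exact exists_sum_pos_of_jobReward_shift_ne hπ hj hω hne
  have hfuture : ∀ i n, μ.real {ω | jobReward π κ j (fun k => Y k ω) i ≠
      jobReward π κ j (truncate 1 (i + 1 + n) fun k => Y k ω) i} ≤ K * ρ ^ n := fun i n => by
    refine (measureReal_le_of_ae_imp ?_).trans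
      ((hbusy (i + 1) (i + 1 + n) (Nat.le_add_right _ n)).trans_eq
        (by rw [Nat.add_sub_cancel_left]))
    filter_upwards [h.ae_pos hδ] with ω hω hne
    exact exists_sum_pos_of_jobReward_truncate_ne hπ hω one_pos (by omega) hne
  have hcov : ∀ i k, i ≤ k → |cov[fun ω => jobReward π κ j (fun l => Y l ω) i,
      fun ω => jobReward π κ j (fun l => Y l ω) k; μ]| ≤ 4 * K * ρ ^ ((k - i - 1) / 2) := by
    intro i k hik
    -- On the diagonal, comparison with the constant `0` gives the bound `4`, and `K ≥ 1`.
    rcases hik.eq_or_lt with rfl | hik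
    · refine (abs_covariance_le (hm i) (fun ω => hmem _ _) measurable_const
        (f' := fun _ => (0 : ℝ)) (fun _ => by simp) (hm i) (fun ω => hmem _ _) measurable_const
        (g' := fun _ => (0 : ℝ)) (fun _ => by simp) (indepFun_const_left _ _)).trans ?_
      have h1 : μ.real {ω | jobReward π κ j (fun l => Y l ω) i ≠ (fun _ => (0 : ℝ)) ω} ≤ 1 :=
        measureReal_le_one
      simp only [Nat.sub_self, Nat.zero_sub, Nat.zero_div, pow_zero]
      linarith
    · obtain ⟨n, rfl⟩ := Nat.exists_eq_add_of_lt hik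
      -- Cut halfway between the two jobs: the earlier reward is replaced by one that ignores gaps
      -- after the cut, the later by one that ignores gaps before it, and these are independent.
      have e1 : i + n + 1 = i + 1 + n / 2 + (n - n / 2) := by omega
      have e2 : (i + n + 1 - i - 1) / 2 = n / 2 := by congr 1; omega
      rw [e2, e1]
      refine (abs_covariance_le (hm i) (fun ω => hmem _ _) (hmt (i + 1 + n / 2) i)
        (fun ω => hmem _ _) (hm _) (fun ω => hmem _ _) (hms (i + 1 + n / 2) (n - n / 2))
        (fun ω => hmem _ _) ((h.indepFun_truncate_shift 1 (i + 1 + n / 2)).comp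
          (measurable_jobReward hπm κ j i) (measurable_jobReward hπm κ j (n - n / 2)))).trans ?_
      have h1 := hfuture i (n / 2)
      have h2 := hpast (i + 1 + n / 2) (n - n / 2)
      have h3 : K * ρ ^ (n - n / 2) ≤ K * ρ ^ (n / 2) :=
        mul_le_mul_of_nonneg_left (pow_le_pow_of_le_one hρ0.le hρ1.le (by omega)) (by linarith)
      linarith
  have hmean : ∀ N k, N ≤ k → dist (∫ ω, jobReward π κ j (fun l => Y l ω) k ∂μ)
      (∫ ω, jobReward π κ j (fun l => Y l ω) N ∂μ) ≤ K * ρ ^ N := by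
    intro N k hNk
    obtain ⟨p, rfl⟩ := Nat.exists_eq_add_of_le' hNk
    rw [Real.dist_eq, ← h.integral_shift (measurable_jobReward hπm κ j N) p]
    exact (abs_integral_sub_integral_le (hm _) (fun ω => hmem _ _) (hms p N)
      (fun ω => hmem _ _)).trans (hpast p N)
  have hcauchy : CauchySeq fun i => ∫ ω, jobReward π κ j (fun l => Y l ω) i ∂μ := by
    refine cauchySeq_of_le_tendsto_0 (fun N => 2 * K * ρ ^ N) (fun n m N hn hm => ?_) ?_
    · have h1 := hmean N n hn
      have h2 := hmean N m hm
      have h3 := dist_triangle_right (∫ ω, jobReward π κ j (fun l => Y l ω) n ∂μ)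
        (∫ ω, jobReward π κ j (fun l => Y l ω) m ∂μ) (∫ ω, jobReward π κ j (fun l => Y l ω) N ∂μ)
      linarith
    · simpa using (tendsto_pow_atTop_nhds_zero_of_lt_one hρ0.le hρ1).const_mul (2 * K)
  obtain ⟨r, hr⟩ := cauchySeq_tendsto_of_complete hcauchy
  exact ⟨r, ae_tendsto_average_of_covariance_le hm (fun i ω => hmem _ i)
    ((summable_pow_half hρ0 hρ1).mul_left (4 * K)) (fun n => by positivity) hcov hr, hr⟩

end ArrivalLaw

end LongTermAverage

/-! ### Comparison of the limits of the expected rewards -/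

section Comparison

variable {Ω : Type*} [MeasurableSpace Ω] {μ : Measure Ω} [IsProbabilityMeasure μ]
  {j δ : ℕ} {Y : ℕ → Ω → ℕ} {κ : ℝ}

open Classical in
/-- Indicator of the event that job `i` is served as soon as it arrives under SPST. -/
noncomputable def servedIndicator (j δ i : ℕ) (y : ℕ → ℕ) : ℝ :=
  if ServedAtOnce j δ y i then 1 else 0

lemma servedIndicator_zero (y : ℕ → ℕ) : servedIndicator j δ 0 y = 1 := if_pos trivial

lemma servedIndicator_succ (i : ℕ) (y : ℕ → ℕ) :
    servedIndicator j δ (i + 1) y =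
      1 - servedIndicator j δ i y * (if y i = j + 1 - δ then 1 else 0) := by
  unfold servedIndicator
  by_cases h1 : ServedAtOnce j δ y i <;> by_cases h2 : y i = j + 1 - δ <;>
    simp [ServedAtOnce, h1, h2]

lemma servedIndicator_mem_Icc (i : ℕ) (y : ℕ → ℕ) :
    servedIndicator j δ i y ∈ Set.Icc (0 : ℝ) 1 := by
  unfold servedIndicator
  split_ifs <;> simp

lemma measurable_servedIndicator (i : ℕ) : Measurable (servedIndicator j δ i) := by
  induction i with
  | zero =>
    simp only [funext (servedIndicator_zero (j := j) (δ := δ))]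
    exact measurable_const
  | succ i ih =>
    rw [funext (servedIndicator_succ (j := j) (δ := δ) i)]
    exact measurable_const.sub (ih.mul ((Measurable.of_discrete
      (f := fun n : ℕ => if n = j + 1 - δ then (1 : ℝ) else 0)).comp (measurable_pi_apply i)))

lemma servedIndicator_truncate (c : ℕ) {i b : ℕ} (hib : i ≤ b) (y : ℕ → ℕ) :
    servedIndicator j δ i (truncate c b y) = servedIndicator j δ i y := by
  induction i with
  | zero => rw [servedIndicator_zero, servedIndicator_zero]
  | succ i ih =>
    rw [servedIndicator_succ, servedIndicator_succ, ih (by omega), truncate_of_lt (by omega)]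

namespace ArrivalLaw

omit [IsProbabilityMeasure μ] in
lemma measurable_servedIndicator_path (h : ArrivalLaw μ j δ Y) (i : ℕ) :
    Measurable fun ω => servedIndicator j δ i fun k => Y k ω :=
  (measurable_servedIndicator i).comp h.measurable_path

-- Whether job `i` is served at once is decided by the gaps before it, so it is independent of the
-- gap `Y i` after it.
omit [IsProbabilityMeasure μ] in
lemma integral_servedIndicator_mul (h : ArrivalLaw μ j δ Y) (i : ℕ) (g : ℕ → ℝ) :
    ∫ ω, servedIndicator j δ i (fun k => Y k ω) * g (Y i ω) ∂μ =
      (∫ ω, servedIndicator j δ i (fun k => Y k ω) ∂μ) * ((g (j + 1 - δ) + g (j + 1 + δ)) / 2) := by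
  have hind := (h.indepFun_truncate_shift 0 i).comp (measurable_servedIndicator (j := j) (δ := δ) i)
    ((Measurable.of_discrete (f := g)).comp (measurable_pi_apply 0))
  have h1 := hind.integral_fun_mul_eq_mul_integral
    (((measurable_servedIndicator i).comp (measurable_truncate 0 i)).comp
      h.measurable_path).aestronglyMeasurable
    (((Measurable.of_discrete (f := g)).comp (measurable_pi_apply 0)).comp
      ((measurable_shift i).comp h.measurable_path)).aestronglyMeasurable
  simp only [Function.comp, servedIndicator_truncate 0 le_rfl, shift, add_zero] at h1
  rw [h1, h.integral_comp]

/-- By independence the probabilities satisfy `p (i + 1) = 1 - p i / 2` with `p 0 = 1`; `0 < δ`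
makes the two gap lengths distinct. -/
lemma integral_servedIndicator (h : ArrivalLaw μ j δ Y) (hδ2 : 0 < δ) (i : ℕ) :
    ∫ ω, servedIndicator j δ i (fun k => Y k ω) ∂μ = 2 / 3 + 1 / 3 * (-1 / 2) ^ i := by
  induction i with
  | zero => simp only [servedIndicator_zero]; norm_num
  | succ i ih =>
    simp only [servedIndicator_succ]
    rw [integral_sub (integrable_const _), h.integral_servedIndicator_mul i
      (fun n => if n = j + 1 - δ then 1 else 0), ih, if_pos rfl, if_neg (by omega)]
    · simp
      ring
    · refine integrable_of_mem_Icc ((h.measurable_servedIndicator_path i).mul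
        ((Measurable.of_discrete (f := fun n : ℕ => if n = j + 1 - δ then (1 : ℝ) else 0)).comp
          (h.measurable i))) fun ω => ?_
      split_ifs
      · simpa using servedIndicator_mem_Icc i _
      · simp

lemma integral_jobReward_FCFS_le (h : ArrivalLaw μ j δ Y) (hκ : 0 ≤ κ) (i : ℕ) :
    ∫ ω, jobReward FCFS κ j (fun k => Y k ω) i ∂μ ≤ Real.exp (-κ * j) := by
  have h1 := integral_mono (integrable_of_mem_Icc (μ := μ)
    (h.measurable_jobReward_path (κ := κ) measurableDiscipline_FCFS i)
    fun ω => reward_mem_Icc hκ _) (integrable_const (Real.exp (-κ * j)))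
    fun ω => reward_le_of_le hκ size_le_sojourn
  simpa using h1

lemma integral_jobReward_FCFS_succ_le (h : ArrivalLaw μ j δ Y) (hj : 0 < j) (hδ : 2 * δ ≤ j)
    (hδ2 : 2 ≤ δ) (hκ : 0 ≤ κ) (i : ℕ) :
    ∫ ω, jobReward FCFS κ j (fun k => Y k ω) (i + 1) ∂μ ≤
      (Real.exp (-κ * (j + (δ - 1) : ℕ)) + Real.exp (-κ * j)) / 2 := by
  set g : ℕ → ℝ := fun n =>
    if n = j + 1 - δ then Real.exp (-κ * (j + (δ - 1) : ℕ)) else Real.exp (-κ * j) with hg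
  have h1 : ∫ ω, g (Y i ω) ∂μ =
      (Real.exp (-κ * (j + (δ - 1) : ℕ)) + Real.exp (-κ * j)) / 2 := by
    rw [h.integral_comp]
    simp only [hg]
    rw [if_pos trivial, if_neg (by omega)]
  rw [← h1]
  have hexp : ∀ n : ℕ, Real.exp (-κ * n) ∈ Set.Icc (0 : ℝ) 1 := fun n =>
    ⟨(Real.exp_pos _).le, Real.exp_le_one_iff.2 (by
      have := mul_nonneg hκ (Nat.cast_nonneg (α := ℝ) n); linarith)⟩
  refine integral_mono_ae (integrable_of_mem_Icc
    (h.measurable_jobReward_path measurableDiscipline_FCFS _) fun ω => reward_mem_Icc hκ _)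
    (integrable_of_mem_Icc ((Measurable.of_discrete (f := g)).comp (h.measurable i))
      fun ω => ?_) ?_
  · simp only [hg]
    split_ifs
    exacts [hexp _, hexp _]
  · filter_upwards [h.ae_pos hδ] with ω hω
    simp only [hg]
    split_ifs with hi
    · exact reward_le_of_le hκ (le_sojourn_FCFS hj hδ hδ2 hω hi)
    · exact reward_le_of_le hκ size_le_sojourn

lemma le_integral_jobReward_SPST_of_le_one (h : ArrivalLaw μ j δ Y) (hj : 0 < j) (hδ1 : δ ≤ 1)
    (hκ : 0 ≤ κ) (i : ℕ) :
    Real.exp (-κ * j) ≤ ∫ ω, jobReward SPST κ j (fun k => Y k ω) i ∂μ := by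
  have h1 := integral_mono_ae (integrable_const (μ := μ) (Real.exp (-κ * j)))
    (integrable_of_mem_Icc (μ := μ)
      (h.measurable_jobReward_path (κ := κ) measurableDiscipline_SPST i)
      fun ω => reward_mem_Icc hκ _) (by
    filter_upwards [h.ae_eq_or_eq] with ω hω
    exact le_reward_of_le hκ
      (sojourn_SPST_le_of_size_le hj (fun k => by have := hω k; omega) i))
  simpa using h1

/-- The reward dominates `A` for a job served at once, `B` for another job followed by a long gap,
and `0` otherwise. -/
lemma le_integral_jobReward_SPST (h : ArrivalLaw μ j δ Y) (hδ : 2 * δ ≤ j)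
    (hδ2 : 2 ≤ δ) (hκ : 0 ≤ κ) (i : ℕ) :
    Real.exp (-κ * j) * (2 / 3 + 1 / 3 * (-1 / 2) ^ i) +
      Real.exp (-κ * (j + (δ - 1) : ℕ)) * ((1 - (2 / 3 + 1 / 3 * (-1 / 2) ^ i)) / 2) ≤
      ∫ ω, jobReward SPST κ j (fun k => Y k ω) i ∂μ := by
  set A := Real.exp (-κ * j) with hA
  set B := Real.exp (-κ * (j + (δ - 1) : ℕ)) with hB
  set g : ℕ → ℝ := fun n => if n = j + 1 + δ then B else 0 with hg
  set U : Ω → ℝ := fun ω => servedIndicator j δ i fun k => Y k ω with hU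
  have hUI : Integrable U μ := integrable_of_mem_Icc (h.measurable_servedIndicator_path i)
    fun ω => servedIndicator_mem_Icc i _
  have hgm : Measurable fun ω => g (Y i ω) :=
    (Measurable.of_discrete (f := g)).comp (h.measurable i)
  have hgI : Integrable (fun ω => g (Y i ω)) μ :=
    Integrable.of_bound hgm.aestronglyMeasurable B (ae_of_all _ fun ω => by
      simp only [hg]
      split_ifs
      · exact (Real.abs_exp _).le
      · simpa using (Real.exp_pos _).le)
  have hUgI : Integrable (fun ω => U ω * g (Y i ω)) μ :=
    hgI.bdd_mul (c := 1) hUI.aestronglyMeasurable (ae_of_all _ fun ω => by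
      rw [Real.norm_eq_abs, abs_of_nonneg (servedIndicator_mem_Icc i _).1]
      exact (servedIndicator_mem_Icc i _).2)
  have hDI : Integrable (fun ω => g (Y i ω) - U ω * g (Y i ω)) μ := hgI.sub hUgI
  have hgE : (g (j + 1 - δ) + g (j + 1 + δ)) / 2 = B / 2 := by
    simp only [hg]
    rw [if_pos trivial, if_neg (by omega), zero_add]
  have hUE : ∫ ω, U ω ∂μ = 2 / 3 + 1 / 3 * (-1 / 2) ^ i :=
    h.integral_servedIndicator (by omega) i
  have hE : ∫ ω, (A * U ω + (g (Y i ω) - U ω * g (Y i ω))) ∂μ =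
      A * (2 / 3 + 1 / 3 * (-1 / 2) ^ i) + B * ((1 - (2 / 3 + 1 / 3 * (-1 / 2) ^ i)) / 2) := by
    rw [integral_add (hUI.const_mul A) hDI, integral_const_mul,
      integral_sub hgI hUgI, h.integral_comp, h.integral_servedIndicator_mul, hgE, hUE]
    ring
  rw [← hE]
  refine integral_mono_ae ((hUI.const_mul A).add hDI)
    (integrable_of_mem_Icc (h.measurable_jobReward_path measurableDiscipline_SPST i)
      fun ω => reward_mem_Icc hκ _) ?_
  filter_upwards [h.ae_eq_or_eq] with ω hω
  simp only [hU, servedIndicator]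
  split_ifs with hs
  · rw [mul_one, one_mul, sub_self, add_zero]
    exact le_reward_of_le hκ (hs.sojourn_le hδ hδ2 hω)
  · rw [mul_zero, zero_mul, zero_add, sub_zero]
    simp only [hg]
    split_ifs with hi
    · exact le_reward_of_le hκ (sojourn_le_of_not_servedAtOnce hδ hδ2 hω hs hi)
    · exact (reward_mem_Icc hκ _).1

/-- Under SPST the reward is in the long run at least the one under FCFS, in expectation. -/
lemma lim_FCFS_le_lim_SPST (h : ArrivalLaw μ j δ Y) (hj : 0 < j) (hδ : 2 * δ ≤ j)
    (hκ : Real.log 2 ≤ κ) {rS rF : ℝ}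
    (hS : Tendsto (fun i => ∫ ω, jobReward SPST κ j (fun k => Y k ω) i ∂μ) atTop (𝓝 rS))
    (hF : Tendsto (fun i => ∫ ω, jobReward FCFS κ j (fun k => Y k ω) i ∂μ) atTop (𝓝 rF)) :
    rF ≤ rS := by
  have hκ0 : 0 ≤ κ := (Real.log_nonneg one_le_two).trans hκ
  rcases Nat.lt_or_ge δ 2 with hδ1 | hδ2
  · exact (le_of_tendsto' hF fun i => h.integral_jobReward_FCFS_le hκ0 i).trans
      (ge_of_tendsto' hS fun i => h.le_integral_jobReward_SPST_of_le_one hj (by omega) hκ0 i)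
  set A := Real.exp (-κ * j) with hA
  set B := Real.exp (-κ * (j + (δ - 1) : ℕ)) with hB
  have hF' : rF ≤ (B + A) / 2 := le_of_tendsto' ((tendsto_add_atTop_iff_nat 1).2 hF) fun i =>
    h.integral_jobReward_FCFS_succ_le hj hδ hδ2 hκ0 i
  have hp : Tendsto (fun i : ℕ => (2 : ℝ) / 3 + 1 / 3 * (-1 / 2) ^ i) atTop (𝓝 (2 / 3)) := by
    have := ((tendsto_pow_atTop_nhds_zero_of_abs_lt_one
      (show |(-1 / 2 : ℝ)| < 1 by rw [abs_lt]; norm_num)).const_mul (1 / 3)).const_add (2 / 3)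
    simpa using this
  have hS' : A * (2 / 3) + B * ((1 - 2 / 3) / 2) ≤ rS :=
    le_of_tendsto_of_tendsto' ((hp.const_mul A).add
      (((hp.const_sub 1).div_const 2).const_mul B)) hS fun i =>
        h.le_integral_jobReward_SPST hδ hδ2 hκ0 i
  -- The only use of the size of `κ`: `B = A * exp (-κ (δ - 1))` with `κ (δ - 1) ≥ log 2`.
  have hBA : B ≤ A * (1 / 2) := by
    have h2 : (1 / 2 : ℝ) = Real.exp (-Real.log 2) := by
      rw [Real.exp_neg, Real.exp_log two_pos, one_div]
    rw [h2, hA, hB, ← Real.exp_add]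
    refine Real.exp_le_exp.2 ?_
    have h3 : (1 : ℝ) ≤ ((δ - 1 : ℕ) : ℝ) := by exact_mod_cast (by omega : 1 ≤ δ - 1)
    rw [Nat.cast_add]
    nlinarith
  linarith

end ArrivalLaw

end Comparison

end Queue

theorem proposition1 {Ω : Type*} [MeasurableSpace Ω] (μ : Measure Ω) [IsProbabilityMeasure μ]
    (j δ : ℕ) (hj : 0 < j) (hδ : 2 * δ ≤ j)
    (Y : ℕ → Ω → ℕ) (hYm : ∀ i, Measurable (Y i)) (hYi : iIndepFun Y μ)
    (hY : ∀ i, μ.map (Y i) =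
      (1 / 2 : ℝ≥0∞) • Measure.dirac (j + 1 - δ) + (1 / 2 : ℝ≥0∞) • Measure.dirac (j + 1 + δ))
    (κ : ℝ) (hκ : Real.log 2 ≤ κ) :
    ∃ rSPST rFCFS : ℝ,
      Queue.IsLongTermAverageReward μ Queue.SPST κ j Y rSPST ∧
      Queue.IsLongTermAverageReward μ Queue.FCFS κ j Y rFCFS ∧
      rFCFS ≤ rSPST := by
  have h : Queue.ArrivalLaw μ j δ Y := ⟨hYm, hYi, hY⟩
  have hκ0 : 0 ≤ κ := (Real.log_nonneg one_le_two).trans hκ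
  obtain ⟨rS, hS, hS'⟩ := h.exists_isLongTermAverageReward hj hδ hκ0 Queue.ageBased_SPST
    Queue.measurableDiscipline_SPST
  obtain ⟨rF, hF, hF'⟩ := h.exists_isLongTermAverageReward hj hδ hκ0 Queue.ageBased_FCFS
    Queue.measurableDiscipline_FCFS
  exact ⟨rS, rF, hS, hF, h.lim_FCFS_le_lim_SPST hj hδ hκ hS' hF'⟩
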